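/- Let $(M,g)$ and $(\widetilde M,\widetilde g)$ be connected (smooth, Hausdorff, second countable) Riemannian manifolds of dimension $2m$. The twistor space $\mathcal Z$ of $(M,g)$ is the submanifold of $Hom(TM,TM)$ consisting of all $g$-orthogonal endomorphisms $I$ of tangent spaces $T_pM$ with $I^2=-Id$, with projection $\pi:\mathcal Z\to M$; if $M$ is oriented, the positive twistor space is the set of those $I$ that induce the orientation of $M$. The Levi-Civita connection of $g$ splits the tangent spaces of $\mathcal Z$ into horizontal vectors $X^h_I$ (the horizontal lifts of $X\in T_{\pi(I)}M$) and vertical vectors $U$ (endomorphisms of $T_{\pi(I)}M$ tangent to the fibre at $I$). The Atiyah-Hitchin-Singer and Eells-Salamon almost complex structures $\mathcal J_1$, $\mathcal J_2$ on $\mathcal Z$ are given by $\mathcal J_k(X^h_I+U)=(IX)^h_I+(-1)^{k+1}I\circ U$. Let $\widetilde{\mathcal Z}$, $\widetilde{\mathcal J}_k$ be the corresponding objects for $(\widetilde M,\widetilde g)$. Let $\mathcal Z$, $\widetilde{\mathcal Z}$ be either both the full twistor spaces or, for oriented $M$ and $\widetilde M$, both the positive twistor spaces. Let $\Phi:\mathcal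 Z\to\widetilde{\mathcal Z}$ be a bundle isomorphism, i.e. a diffeomorphism covering a diffeomorphism $\varphi:M\to\widetilde M$. A smooth map $\Phi$ is called holomorphic with respect to $\mathcal J_k$, $\widetilde{\mathcal J}_k$ if $\Phi_*\circ\mathcal J_k=\widetilde{\mathcal J}_k\circ\Phi_*$. (i) $\Phi$ is holomorphic with respect to $\mathcal J_1$ and $\widetilde{\mathcal J}_1$ if and only if $\Phi(I)=\varphi_*\circ I\circ\varphi_*^{-1}$ for every $I\in\mathcal Z$. The latter identity implies that $\varphi$ is conformal, i.e. $\varphi^*\widetilde g=e^{2f}g$ for a smooth function $f$ on $M$. (ii) If $2m\ge 4$, then $\Phi$ is holomorphic with respect to $\mathcal J_2$ and $\widetilde{\mathcal J}_2$ if and only if $\Phi(I)=\varphi_*\circ I\circ\varphi_*^{-1}$ for every $I\in\mathcal Z$ and $\varphi$ is a homothety, i.e. $\varphi^*\widetilde g=e^{2c}g$ for a constant $c$. -/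

import Mathlib

open Bundle Manifold Topology ContDiff

set_option maxSynthPendingDepth 3

noncomputable section

namespace Twistor

variable {E : Type*} [NormedAddCommGroup E] [NormedSpace ℝ E]

section Ambient

variable (E) (M : Type*) [TopologicalSpace M] [ChartedSpace E M] [IsManifold 𝓘(ℝ, E) ∞ M]

/-- The total space of the vector bundle `Hom(TM, TM)` of endomorphisms of the tangent bundle.
A point `z` consists of a point `z.1` of `M` and an endomorphism `z.2` of the tangent space
at `z.1`. -/
abbrev EndTM : Type _ :=
  TotalSpace (E →L[ℝ] E)
    (fun p : M => TangentSpace 𝓘(ℝ, E) p →L[ℝ] TangentSpace 𝓘(ℝ, E) p)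

/-- The model with corners (without boundary) of the manifold `Hom(TM, TM)`. -/
abbrev endModel : ModelWithCorners ℝ (E × (E →L[ℝ] E)) (ModelProd E (E →L[ℝ] E)) :=
  𝓘(ℝ, E).prod 𝓘(ℝ, E →L[ℝ] E)

/-- The tangent bundle of the manifold `Hom(TM, TM)`. -/
abbrev TEndTM : Type _ := TangentBundle (endModel E) (EndTM E M)

/-- Smooth Riemannian metrics on `M`. -/
abbrev Metric : Type _ :=
  ContMDiffRiemannianMetric 𝓘(ℝ, E) ∞ E (fun p : M => TangentSpace 𝓘(ℝ, E) p)

/-- An orientation of the manifold `M` of dimension `2m`: an orientation of each tangent space,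
locally constant with respect to the coordinate frames. Bases of tangent spaces are indexed by
`Fin m × Fin 2` (in lexicographic order). -/
structure ManifoldOrientation (m : ℕ) where
  /-- the orientation of the tangent space at `p` -/
  at' (p : M) : Orientation ℝ (TangentSpace 𝓘(ℝ, E) p) (Fin m × Fin 2)
  /-- in the coordinate frame around `p`, the orientations at `p` and at nearby `q` agree -/
  locally_constant (p : M) :
    ∀ᶠ q in 𝓝 p, ∀ hq : q ∈ (trivializationAt E (TangentSpace 𝓘(ℝ, E)) p).baseSet,
      Orientation.map (Fin m × Fin 2)
          ((trivializationAt E (TangentSpace 𝓘(ℝ, E)) p).linearEquivAt ℝ q hq) (at' q) =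
        Orientation.map (Fin m × Fin 2)
          ((trivializationAt E (TangentSpace 𝓘(ℝ, E)) p).linearEquivAt ℝ p
            (FiberBundle.mem_baseSet_trivializationAt' p)) (at' p)

end Ambient

section TwistorSpace

variable {M : Type*} [TopologicalSpace M] [ChartedSpace E M] [IsManifold 𝓘(ℝ, E) ∞ M]

/-- The twistor space of `(M, g)`: all `g`-orthogonal complex structures on tangent spaces of `M`,
as a subset (in fact a submanifold) of `Hom(TM, TM)`. -/
def twistorSpace (g : Metric E M) : Set (EndTM E M) :=
  {z | z.2 ∘L z.2 = -ContinuousLinearMap.id ℝ (TangentSpace 𝓘(ℝ, E) z.1) ∧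
    ∀ u v : TangentSpace 𝓘(ℝ, E) z.1, g.inner z.1 (z.2 u) (z.2 v) = g.inner z.1 u v}

/-- A complex structure `J` on a vector space induces the orientation `o` if the bases of the form
`e₁, J e₁, …, eₘ, J eₘ` are positively oriented. -/
def Induces {m : ℕ} {V : Type*} [AddCommGroup V] [Module ℝ V] (J : V → V)
    (o : Orientation ℝ V (Fin m × Fin 2)) : Prop :=
  ∃ b : Module.Basis (Fin m × Fin 2) ℝ V, (∀ k, b (k, 1) = J (b (k, 0))) ∧ b.orientation = o

/-- The positive twistor space of the oriented Riemannian manifold `(M, g)`. -/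
def positiveTwistorSpace {m : ℕ} (g : Metric E M) (o : ManifoldOrientation E M m) :
    Set (EndTM E M) :=
  {z | z ∈ twistorSpace g ∧ Induces z.2 (o.at' z.1)}

end TwistorSpace

section LeviCivita

variable {M : Type*} [TopologicalSpace M] [ChartedSpace E M] [IsManifold 𝓘(ℝ, E) ∞ M]

/-- The matrix of the metric in the coordinate frame of the chart at `p`, as a function of the
point `q` near `p`. -/
def metricCoord (g : Metric E M) (p q : M) : E →L[ℝ] E →L[ℝ] ℝ :=
  (trivializationAt (E →L[ℝ] E →L[ℝ] ℝ)
    (fun x : M => TangentSpace 𝓘(ℝ, E) x →L[ℝ] TangentSpace 𝓘(ℝ, E) x →L[ℝ] ℝ) p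
    ⟨q, g.inner q⟩).2

/-- The first derivatives at `p` of the matrix of the metric in the chart at `p`:
`metricDeriv g p X Y Z` is `(∂_X g)(Y, Z)`. -/
def metricDeriv (g : Metric E M) (p : M) : E →L[ℝ] E →L[ℝ] E →L[ℝ] ℝ :=
  mfderiv 𝓘(ℝ, E) 𝓘(ℝ, E →L[ℝ] E →L[ℝ] ℝ) (metricCoord g p) p

/-- Christoffel symbols of the first kind at `p`, in the chart at `p`:
`Γ(X, Y, Z) = ½ ((∂_X g)(Y, Z) + (∂_Y g)(X, Z) - (∂_Z g)(X, Y))`. -/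
def christoffelLower (g : Metric E M) (p : M) : E →L[ℝ] E →L[ℝ] E →L[ℝ] ℝ :=
  let A : E →L[ℝ] E →L[ℝ] E →L[ℝ] ℝ := metricDeriv g p
  let B : E →L[ℝ] E →L[ℝ] E →L[ℝ] ℝ := ContinuousLinearMap.flip A
  let flip : (E →L[ℝ] E →L[ℝ] ℝ) →L[ℝ] (E →L[ℝ] E →L[ℝ] ℝ) :=
    (ContinuousLinearMap.flipₗᵢ ℝ E E ℝ).toContinuousLinearEquiv.toContinuousLinearMap
  let C : E →L[ℝ] E →L[ℝ] E →L[ℝ] ℝ := flip ∘L B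
  (1 / 2 : ℝ) • (A + B - C)

/-- Christoffel symbols at `p` of the Levi-Civita connection of `g`, in the chart at `p`:
`g (Γ(X, Y), Z) = Γ(X, Y, Z)`. -/
def christoffel (g : Metric E M) (p : M) : E →L[ℝ] E →L[ℝ] E :=
  ContinuousLinearMap.compL ℝ E (E →L[ℝ] ℝ) E (metricCoord g p p).inverse ∘L christoffelLower g p

/-- The endomorphism `z.2` in the coordinate frame of the chart at `p`, for `z.1` near `p`. -/
def endCoord (p : M) (z : EndTM E M) : E →L[ℝ] E :=
  (trivializationAt (E →L[ℝ] E)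
    (fun x : M => TangentSpace 𝓘(ℝ, E) x →L[ℝ] TangentSpace 𝓘(ℝ, E) x) p z).2

/-- The differential at `z` of the bundle projection `π : Hom(TM, TM) → M`. -/
def projDeriv (z : EndTM E M) : (E × (E →L[ℝ] E)) →L[ℝ] E :=
  mfderiv (endModel E) 𝓘(ℝ, E) (TotalSpace.proj : EndTM E M → M) z

/-- The connection map at `z` of the connection induced on `Hom(TM, TM)` by the Levi-Civita
connection of `g`. In the chart at `p = π z` it is `v ↦ ∂_v + [Γ(π_* v, ·), z]`, so that a local
section `S` of `Hom(TM, TM)` with `S p = z` has `connector (S_* X) = ∇_X S`. -/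
def connector (g : Metric E M) (z : EndTM E M) : (E × (E →L[ℝ] E)) →L[ℝ] (E →L[ℝ] E) :=
  let J : E →L[ℝ] E := z.2
  let D : (E × (E →L[ℝ] E)) →L[ℝ] (E →L[ℝ] E) :=
    mfderiv (endModel E) 𝓘(ℝ, E →L[ℝ] E) (endCoord z.1) z
  let Γ : (E × (E →L[ℝ] E)) →L[ℝ] (E →L[ℝ] E) := christoffel g z.1 ∘L projDeriv z
  D + (ContinuousLinearMap.compL ℝ E E E).flip J ∘L Γ - ContinuousLinearMap.compL ℝ E E E J ∘L Γ

/-- The splitting of the tangent space of `Hom(TM, TM)` at `z` into horizontal and vertical parts,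
`v ↦ (π_* v, connector v)`; it is a linear isomorphism. -/
def split (g : Metric E M) (z : EndTM E M) :
    (E × (E →L[ℝ] E)) →L[ℝ] (E × (E →L[ℝ] E)) :=
  (projDeriv z).prod (connector g z)

/-- The horizontal lift `X^h` at `z`: `π_* X^h = X` and `connector X^h = 0`. -/
def horizontalLift (g : Metric E M) (z : EndTM E M) (X : E) : E × (E →L[ℝ] E) :=
  (split g z).inverse (X, 0)

/-- The endomorphism `U` of the tangent space at `π z` as a vertical tangent vector at `z`:
`π_* U = 0` and `connector U = U`. -/
def verticalLift (g : Metric E M) (z : EndTM E M) (U : E →L[ℝ] E) : E × (E →L[ℝ] E) :=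
  (split g z).inverse (0, U)

/-- For `ε = ±1`, the map sending a tangent vector `X^h + U` at `z` (with `U` vertical) to
`(z X)^h + ε z ∘ U`. -/
def almostComplex (g : Metric E M) (ε : ℝ) (v : TEndTM E M) : TEndTM E M :=
  let z : EndTM E M := v.1
  let J : E →L[ℝ] E := z.2
  ⟨z, (horizontalLift g z (J (projDeriv z v.2)) +
    verticalLift g z (ε • (J ∘L connector g z v.2)) : E × (E →L[ℝ] E))⟩

/-- The Atiyah-Hitchin-Singer almost complex structure (on vectors tangent to the twistor
space). -/
def J₁ (g : Metric E M) : TEndTM E M → TEndTM E M := almostComplex g 1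

/-- The Eells-Salamon almost complex structure (on vectors tangent to the twistor space). -/
def J₂ (g : Metric E M) : TEndTM E M → TEndTM E M := almostComplex g (-1)

end LeviCivita

section Maps

variable {M : Type*} [TopologicalSpace M] [ChartedSpace E M] [IsManifold 𝓘(ℝ, E) ∞ M]
  {M' : Type*} [TopologicalSpace M'] [ChartedSpace E M'] [IsManifold 𝓘(ℝ, E) ∞ M']

/-- The vectors tangent to a submanifold `Z` of `Hom(TM, TM)`: the velocities of smooth curves
in `Z`. -/
def tangentVectors (Z : Set (EndTM E M)) : Set (TEndTM E M) :=
  {v | ∃ c : ℝ → EndTM E M, ContMDiff 𝓘(ℝ, ℝ) (endModel E) ∞ c ∧ (∀ t, c t ∈ Z) ∧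
    tangentMap 𝓘(ℝ, ℝ) (endModel E) c ⟨0, (1 : ℝ)⟩ = v}

/-- `F` is a smooth extension near `z` of the map `f` between subsets. -/
def IsSmoothExtensionAt {Z : Set (EndTM E M)} {Z' : Set (EndTM E M')} (f : Z → Z') (z : Z)
    (F : EndTM E M → EndTM E M') : Prop :=
  ContMDiffAt (endModel E) (endModel E) ∞ F z ∧ ∀ᶠ w : Z in 𝓝 z, F w = f w

/-- A map between submanifolds is smooth if it extends locally to smooth maps of the ambient
manifolds. -/
def IsSmooth {Z : Set (EndTM E M)} {Z' : Set (EndTM E M')} (f : Z → Z') : Prop :=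
  ∀ z : Z, ∃ F, IsSmoothExtensionAt f z F

/-- A bundle isomorphism `Z → Z'` covering a diffeomorphism `M → M'`. -/
structure BundleIso (Z : Set (EndTM E M)) (Z' : Set (EndTM E M')) where
  /-- the bijection of total spaces -/
  toEquiv : Z ≃ Z'
  smooth_toFun : IsSmooth toEquiv
  smooth_invFun : IsSmooth toEquiv.symm
  /-- the induced diffeomorphism of the bases -/
  base : M ≃ₘ^∞⟮𝓘(ℝ, E), 𝓘(ℝ, E)⟯ M'
  proj_toEquiv (z : Z) : (toEquiv z).1.1 = base z.1.1

/-- `f : (Z, 𝒥) → (Z', 𝒥')` is holomorphic: `f_* ∘ 𝒥 = 𝒥' ∘ f_*` on vectors tangent to `Z`. The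
differential `f_*` is that of any local smooth extension of `f`. -/
def IsHolomorphic {Z : Set (EndTM E M)} {Z' : Set (EndTM E M')} (f : Z → Z')
    (𝒥 : TEndTM E M → TEndTM E M) (𝒥' : TEndTM E M' → TEndTM E M') : Prop :=
  IsSmooth f ∧ ∀ (z : Z) (F : EndTM E M → EndTM E M'), IsSmoothExtensionAt f z F →
    ∀ v ∈ tangentVectors Z, v.1 = z →
      tangentMap (endModel E) (endModel E) F (𝒥 v) = 𝒥' (tangentMap (endModel E) (endModel E) F v)

/-- The endomorphism `φ_* ∘ J ∘ φ_*⁻¹` of the tangent space at `φ p`, for an endomorphism `J` of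
the tangent space at `p`. -/
def conjugate (φ : M ≃ₘ^∞⟮𝓘(ℝ, E), 𝓘(ℝ, E)⟯ M') (z : EndTM E M) : EndTM E M' :=
  let A := φ.mfderivToContinuousLinearEquiv (by simp) z.1
  ⟨φ z.1, A.toContinuousLinearMap ∘L z.2 ∘L A.symm.toContinuousLinearMap⟩

/-- `φ` is conformal: `φ^* g' = e^{2f} g` for a smooth function `f`. -/
def IsConformal (g : Metric E M) (g' : Metric E M') (φ : M → M') : Prop :=
  ∃ f : M → ℝ, ContMDiff 𝓘(ℝ, E) 𝓘(ℝ, ℝ) ∞ f ∧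
    ∀ (p : M) (u v : TangentSpace 𝓘(ℝ, E) p),
      g'.inner (φ p) (mfderiv 𝓘(ℝ, E) 𝓘(ℝ, E) φ p u) (mfderiv 𝓘(ℝ, E) 𝓘(ℝ, E) φ p v) =
        Real.exp (2 * f p) * g.inner p u v

/-- `φ` is a homothety: `φ^* g' = e^{2c} g` for a constant `c`. -/
def IsHomothety (g : Metric E M) (g' : Metric E M') (φ : M → M') : Prop :=
  ∃ c : ℝ, ∀ (p : M) (u v : TangentSpace 𝓘(ℝ, E) p),
    g'.inner (φ p) (mfderiv 𝓘(ℝ, E) 𝓘(ℝ, E) φ p u) (mfderiv 𝓘(ℝ, E) 𝓘(ℝ, E) φ p v) =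
      Real.exp (2 * c) * g.inner p u v

end Maps

end Twistor

end

/-! Let `L` and `H` be the first and second derivatives of `φ` in the charts centred at `p` and `φ
p`. A tangent vector at `I` over `p` is a pair `(X, W)`, and the structure with sign `ε` sends it to
`(I X, ε I (W + [Γ_X, I]) - [Γ_{I X}, I])` (`almostComplex_apply`). Since `Φ` covers `φ`, its
differential has first component `L X`. For either sign, the first component of the holomorphy
equation therefore says `L (I X) = Φ(I) (L X)`, so `Φ` is conjugation by the differential
(`eq_conjugate_of_isHolomorphic`).

If `Φ` is conjugation, the pullback of the second metric is invariant under every `I` in `Z`. Each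
orthonormal pair `u, v` admits such an `I` with `I u = ±v`, so the pullback is a multiple of `g`
(`proportional_of_invariant`), with a smooth factor `exp (2 h)` (`exists_conformal_factor`).

The second component remains. Put `a = grad h`. Up to the Hessian `H`, the two connections differ by
`S_X Y = g(a, X) Y + g(a, Y) X - g(X, Y) a` (`christoffel_conformal`). The terms in `W`, `Γ` and `H`
cancel, and holomorphy becomes `C(I X) = ε I C(X)` with `C(X) = [S_X, I]`
(`holomorphic_iff_conformalTerm`). Orthogonality of `I` always gives `C(I X) = I C(X)`, which
settles `ε = 1`. For `ε = -1` it forces `C = 0`, hence `a = 0` in dimension at least three, and `h`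
is constant by connectedness.

All this needs enough tangent vectors: every solution `(X, W)` of the linearized equations of `Z`
must be the velocity of a curve in `Z` (`exists_deformation`, `exists_curve`). `IsTwistorFamily`
collects what is used about `Z`, so that the full and the positive twistor spaces are treated
together. -/

set_option linter.unusedSectionVars false

noncomputable section

namespace Twistor

variable {E : Type*} [NormedAddCommGroup E] [NormedSpace ℝ E]

/-! ### Metrics, connections and almost complex structures in the chart centred at a point. -/

section Coordinates

variable {M : Type*} [TopologicalSpace M] [ChartedSpace E M] [IsManifold 𝓘(ℝ, E) ∞ M]

/-- The coordinate frame of the chart at `p`, as a map from the tangent space at `q`. -/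
def frame (p q : M) : E →L[ℝ] E :=
  (trivializationAt E (TangentSpace 𝓘(ℝ, E)) p).continuousLinearMapAt ℝ q

/-- The inverse of `frame p q`. -/
def coframe (p q : M) : E →L[ℝ] E :=
  (trivializationAt E (TangentSpace 𝓘(ℝ, E)) p).symmL ℝ q

/-- The endomorphism underlying a point of `Hom(TM, TM)`. -/
def endo (z : EndTM E M) : E →L[ℝ] E := z.2

/-- The metric on the tangent space at `p`, as a bilinear form on the model space. -/
def form (g : Metric E M) (p : M) : E →L[ℝ] E →L[ℝ] ℝ := g.inner p

theorem form_symm (g : Metric E M) (p : M) (u v : E) : form g p u v = form g p v u :=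
  g.symm p u v

theorem form_pos (g : Metric E M) (p : M) {u : E} (hu : u ≠ 0) : 0 < form g p u u :=
  g.pos p u hu

theorem endCoord_eq (p : M) (z : EndTM E M) :
    endCoord p z = frame p z.1 ∘L endo z ∘L coframe p z.1 := rfl

theorem metricCoord_apply (g : Metric E M) {p q : M} (hq : q ∈ (chartAt E p).source) (u v : E) :
    metricCoord g p q u v = form g q (coframe p q u) (coframe p q v) := by
  refine (inCoordinates_apply_eq₂ (𝕜 := ℝ) (F₁ := E) (F₂ := E) (F₃ := ℝ)
    (E₁ := (TangentSpace 𝓘(ℝ, E) : M → Type _)) (E₂ := (TangentSpace 𝓘(ℝ, E) : M → Type _))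
    (E₃ := fun _ : M => ℝ) (x₀ := p) (x := q) (ϕ := g.inner q) (v := u) (w := v) hq hq
    (by trivial)).trans ?_
  have h : ∀ w, coframe p q w = (trivializationAt E (TangentSpace 𝓘(ℝ, E)) p).symm q w :=
    fun w => Trivialization.symmL_apply _ hq w
  rw [h, h]
  simp [form]
  rfl

theorem frame_coframe {p q : M} (hq : q ∈ (chartAt E p).source) (u : E) :
    frame p q (coframe p q u) = u :=
  (trivializationAt E (TangentSpace 𝓘(ℝ, E)) p).continuousLinearMapAt_symmL hq u

theorem coframe_frame {p q : M} (hq : q ∈ (chartAt E p).source) (u : E) :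
    coframe p q (frame p q u) = u :=
  (trivializationAt E (TangentSpace 𝓘(ℝ, E)) p).symmL_continuousLinearMapAt hq u

theorem frame_comp_coframe {p q : M} (hq : q ∈ (chartAt E p).source) :
    frame (E := E) p q ∘L coframe p q = .id ℝ E :=
  ContinuousLinearMap.ext (frame_coframe hq)

theorem frame_eq_mfderiv {p q : M} (hq : q ∈ (chartAt E p).source) :
    frame (E := E) p q = mfderiv 𝓘(ℝ, E) 𝓘(ℝ, E) (extChartAt 𝓘(ℝ, E) p) q :=
  TangentBundle.continuousLinearMapAt_trivializationAt hq

theorem coframe_eq_mfderiv {p q : M} (hq : q ∈ (chartAt E p).source) :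
    coframe (E := E) p q =
      mfderiv 𝓘(ℝ, E) 𝓘(ℝ, E) (extChartAt 𝓘(ℝ, E) p).symm (extChartAt 𝓘(ℝ, E) p q) := by
  refine (TangentBundle.symmL_trivializationAt hq).trans ?_
  rw [ModelWithCorners.range_eq_univ, mfderivWithin_univ]

/-- The tangent space at `p` is identified with `E` through the preferred chart at `p`. Hence
pointwise data at `p` need no change of frame in that chart, and every computation is made at the
centre of a chart. -/
theorem frame_self (p : M) : frame (E := E) p p = .id ℝ E :=
  (frame_eq_mfderiv (mem_chart_source E p)).trans mfderiv_extChartAt_self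

theorem coframe_self (p : M) : coframe (E := E) p p = .id ℝ E := by
  have h := frame_comp_coframe (mem_chart_source E p)
  rwa [frame_self, ContinuousLinearMap.id_comp] at h

/-- The metric in the chart at `p`, as a function on the model space. -/
def localMetric (g : Metric E M) (p : M) (x : E) : E →L[ℝ] E →L[ℝ] ℝ :=
  metricCoord g p ((extChartAt 𝓘(ℝ, E) p).symm x)

theorem metricCoord_self (g : Metric E M) (p : M) : metricCoord g p p = form g p := by
  ext u v
  rw [metricCoord_apply g (mem_chart_source E p), coframe_self]
  rfl

theorem localMetric_base (g : Metric E M) (p : M) :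
    localMetric g p (extChartAt 𝓘(ℝ, E) p p) = form g p := by
  rw [localMetric, extChartAt_to_inv, metricCoord_self]

theorem target_mem_nhds (p : M) {x : E} (hx : x ∈ (extChartAt 𝓘(ℝ, E) p).target) :
    (extChartAt 𝓘(ℝ, E) p).target ∈ 𝓝 x :=
  (isOpen_extChartAt_target p).mem_nhds hx

theorem contMDiffOn_metricCoord (g : Metric E M) (p : M) :
    ContMDiffOn 𝓘(ℝ, E) 𝓘(ℝ, E →L[ℝ] E →L[ℝ] ℝ) ∞ (metricCoord g p) (chartAt E p).source := by
  have h := (Bundle.Trivialization.contMDiffOn_section_baseSet_iff (n := ∞) (IB := 𝓘(ℝ, E))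
    (e := (trivializationAt (E →L[ℝ] E →L[ℝ] ℝ)
    (fun x : M => TangentSpace 𝓘(ℝ, E) x →L[ℝ] TangentSpace 𝓘(ℝ, E) x →L[ℝ] ℝ) p))
    (s := g.inner)).1 g.contMDiff.contMDiffOn
  refine h.mono fun q hq => ⟨hq, hq, by trivial⟩

theorem contDiffAt_localMetric (g : Metric E M) (p : M) {x : E}
    (hx : x ∈ (extChartAt 𝓘(ℝ, E) p).target) : ContDiffAt ℝ ∞ (localMetric g p) x := by
  refine ContMDiffAt.contDiffAt ?_
  refine ContMDiffAt.comp (I' := 𝓘(ℝ, E)) x ?_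
    (contMDiffOn_extChartAt_symm p |>.contMDiffAt (target_mem_nhds p hx))
  have h2 : (extChartAt 𝓘(ℝ, E) p).symm x ∈ (chartAt E p).source := by
    simpa using (extChartAt 𝓘(ℝ, E) p).map_target hx
  exact (contMDiffOn_metricCoord g p).contMDiffAt ((chartAt E p).open_source.mem_nhds h2)

theorem base_mem_target (p : M) :
    extChartAt 𝓘(ℝ, E) p p ∈ (extChartAt 𝓘(ℝ, E) p).target := mem_extChartAt_target p

theorem symm_mem_source {p : M} {x : E} (hx : x ∈ (extChartAt 𝓘(ℝ, E) p).target) :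
    (extChartAt 𝓘(ℝ, E) p).symm x ∈ (chartAt E p).source := by
  simpa using (extChartAt 𝓘(ℝ, E) p).map_target hx

theorem metricDeriv_eq (g : Metric E M) (p : M) :
    metricDeriv g p = fderiv ℝ (localMetric g p) (extChartAt 𝓘(ℝ, E) p p) := by
  have h : MDifferentiableAt 𝓘(ℝ, E) 𝓘(ℝ, E →L[ℝ] E →L[ℝ] ℝ) (metricCoord g p) p :=
    ((contMDiffOn_metricCoord g p).contMDiffAt
      ((chartAt E p).open_source.mem_nhds (mem_chart_source E p))).mdifferentiableAt (by simp)
  rw [metricDeriv, h.mfderiv]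
  simp only [ModelWithCorners.range_eq_univ, fderivWithin_univ]
  rfl

theorem localMetric_symm (g : Metric E M) {p : M} {x : E}
    (hx : x ∈ (extChartAt 𝓘(ℝ, E) p).target) (u v : E) :
    localMetric g p x u v = localMetric g p x v u := by
  rw [localMetric, metricCoord_apply g (symm_mem_source hx),
    metricCoord_apply g (symm_mem_source hx), form_symm]

theorem metricDeriv_symm (g : Metric E M) (p : M) (X u v : E) :
    metricDeriv g p X u v = metricDeriv g p X v u := by
  have h := ((contDiffAt_localMetric g p (base_mem_target p)).differentiableAt
    (by simp)).hasFDerivAt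
  have h1 : ∀ u v, HasFDerivAt (fun x => localMetric g p x u v) _ (extChartAt 𝓘(ℝ, E) p p) :=
    fun u v => (h.clm_apply (hasFDerivAt_const u _)).clm_apply (hasFDerivAt_const v _)
  have h2 := (h1 u v).unique ((h1 v u).congr_of_eventuallyEq
    (Filter.eventuallyEq_of_mem (target_mem_nhds p (base_mem_target p))
      fun x hx => localMetric_symm g hx u v))
  have h3 := DFunLike.congr_fun h2 X
  simpa [metricDeriv_eq] using h3

/-! ### Tangent vectors of `Hom(TM, TM)` in coordinates -/

theorem extChartAt_endTM (z w : EndTM E M) :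
    extChartAt (endModel E) z w = (extChartAt 𝓘(ℝ, E) z.1 w.1, endCoord z.1 w) := by
  rw [FiberBundle.extChartAt]
  rfl

theorem mfderiv_extChartAt_endTM (z : EndTM E M) :
    mfderiv (endModel E) 𝓘(ℝ, E × (E →L[ℝ] E)) (extChartAt (endModel E) z) z =
      ContinuousLinearMap.id ℝ (E × (E →L[ℝ] E)) :=
  mfderiv_extChartAt_self

theorem mdifferentiableAt_extChartAt_endTM (z : EndTM E M) :
    MDifferentiableAt (endModel E) 𝓘(ℝ, E × (E →L[ℝ] E)) (extChartAt (endModel E) z) z :=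
  mdifferentiableAt_extChartAt (mem_chart_source _ _)

theorem mfderiv_endCoord (z : EndTM E M) :
    (mfderiv (endModel E) 𝓘(ℝ, E →L[ℝ] E) (endCoord z.1) z :
      (E × (E →L[ℝ] E)) →L[ℝ] (E →L[ℝ] E)) = ContinuousLinearMap.snd ℝ E (E →L[ℝ] E) := by
  have h : endCoord z.1 = Prod.snd ∘ extChartAt (endModel E) z := by
    ext1 w
    rw [Function.comp, extChartAt_endTM]
  have h1 := (mdifferentiableAt_extChartAt_endTM z).hasMFDerivAt
  rw [mfderiv_extChartAt_endTM] at h1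
  rw [h]
  exact ((ContinuousLinearMap.snd ℝ E (E →L[ℝ] E)).hasMFDerivAt.comp z h1).mfderiv

theorem projDeriv_eq (z : EndTM E M) : projDeriv z = ContinuousLinearMap.fst ℝ E (E →L[ℝ] E) := by
  have h : extChartAt 𝓘(ℝ, E) z.1 ∘ (TotalSpace.proj : EndTM E M → M) =
      Prod.fst ∘ extChartAt (endModel E) z := by
    ext1 w
    rw [Function.comp, Function.comp, extChartAt_endTM]
  have h1 := (mdifferentiableAt_extChartAt_endTM z).hasMFDerivAt
  rw [mfderiv_extChartAt_endTM] at h1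
  have h2 := (ContinuousLinearMap.fst ℝ E (E →L[ℝ] E)).hasMFDerivAt.comp z h1
  have h3 : MDifferentiableAt (endModel E) 𝓘(ℝ, E) (TotalSpace.proj : EndTM E M → M) z :=
    (contMDiffAt_proj (n := ∞) _).mdifferentiableAt (by simp)
  have h4 := (mdifferentiableAt_extChartAt (I := 𝓘(ℝ, E))
    (mem_chart_source E z.1)).hasMFDerivAt.comp z h3.hasMFDerivAt
  rw [mfderiv_extChartAt_self] at h4
  exact hasMFDerivAt_unique (h ▸ h4) h2

/-- Positivity gives injectivity and the dimensions agree. This makes the `inverse` in `christoffel`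
and `gradient` a genuine inverse instead of the default value zero. -/
theorem form_invertible [FiniteDimensional ℝ E] (g : Metric E M) (p : M) :
    (form g p).IsInvertible := by
  have hinj : Function.Injective (form g p).toLinearMap := by
    rw [injective_iff_map_eq_zero]
    intro u hu
    by_contra h
    have := form_pos g p h
    have h0 : form g p u = 0 := hu
    simp [h0] at this
  have hdim : Module.finrank ℝ E = Module.finrank ℝ (E →L[ℝ] ℝ) := by
    rw [← LinearMap.toContinuousLinearMap.finrank_eq]
    exact Subspace.dual_finrank_eq.symm
  exact ⟨(LinearEquiv.ofInjectiveOfFinrankEq (form g p).toLinearMap hinj hdim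
    ).toContinuousLinearEquiv, by ext; rfl⟩

theorem form_christoffel [FiniteDimensional ℝ E] (g : Metric E M) (p : M) (X Y Z : E) :
    form g p (christoffel g p X Y) Z =
      (1 / 2) * (metricDeriv g p X Y Z + metricDeriv g p Y X Z - metricDeriv g p Z X Y) := by
  have h : form g p ((form g p).inverse (christoffelLower g p X Y)) = christoffelLower g p X Y :=
    (form_invertible g p).self_apply_inverse _
  have h2 : christoffel g p X Y = (form g p).inverse (christoffelLower g p X Y) := by
    rw [christoffel, metricCoord_self]
    rfl
  rw [h2, h]
  simp [christoffelLower]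

theorem connector_apply (g : Metric E M) (z : EndTM E M) (X : E) (W : E →L[ℝ] E) :
    connector g z (X, W) =
      W + (christoffel g z.1 X ∘L endo z - endo z ∘L christoffel g z.1 X) := by
  rw [connector, mfderiv_endCoord, projDeriv_eq, ← add_sub_assoc]
  rfl

theorem split_inverse_apply (g : Metric E M) (z : EndTM E M) (X : E) (U : E →L[ℝ] E) :
    (split g z).inverse (X, U) =
      (X, U - (christoffel g z.1 X ∘L endo z - endo z ∘L christoffel g z.1 X)) := by
  -- The splitting is the shear `(X, W) ↦ (X, W + [Γ_X, z])`; subtracting `connector` from twice the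
  -- second component changes the sign of the bracket.
  let e : (E × (E →L[ℝ] E)) ≃L[ℝ] (E × (E →L[ℝ] E)) :=
    ContinuousLinearEquiv.equivOfInverse (split g z)
      ((ContinuousLinearMap.fst ℝ E (E →L[ℝ] E)).prod
        ((2 : ℝ) • ContinuousLinearMap.snd ℝ E (E →L[ℝ] E) - connector g z))
      (by
        rintro ⟨Y, V⟩
        simp [split, projDeriv_eq, connector_apply, two_smul])
      (by
        rintro ⟨Y, V⟩
        simp [split, projDeriv_eq, connector_apply, two_smul])
  have h : split g z = e := rfl
  rw [h, ContinuousLinearMap.inverse_equiv]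
  change (X, (2 : ℝ) • U - connector g z (X, U)) = _
  rw [connector_apply, two_smul]
  congr 1
  abel

theorem almostComplex_apply (g : Metric E M) (ε : ℝ) (z : EndTM E M) (X : E) (W : E →L[ℝ] E) :
    almostComplex g ε ⟨z, (X, W)⟩ = ⟨z, (endo z X,
      ε • (endo z ∘L
        (W + (christoffel g z.1 X ∘L endo z - endo z ∘L christoffel g z.1 X))) -
      (christoffel g z.1 (endo z X) ∘L endo z - endo z ∘L christoffel g z.1 (endo z X)))⟩ := by
  have h : almostComplex g ε ⟨z, (X, W)⟩ = ⟨z, (split g z).inverse (endo z (projDeriv z (X, W)), 0) +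
      (split g z).inverse (0, ε • (endo z ∘L connector g z (X, W)))⟩ := rfl
  rw [h, split_inverse_apply, split_inverse_apply, projDeriv_eq, connector_apply]
  simp only [ContinuousLinearMap.coe_fst', Prod.mk_add_mk, map_zero, add_zero,
    ContinuousLinearMap.zero_comp, ContinuousLinearMap.comp_zero, sub_zero, zero_sub]
  congr 2
  abel

/-! ### Curves in `Hom(TM, TM)` -/

/-- The velocity at time `0` of a curve in `Hom(TM, TM)`. -/
def velocity (c : ℝ → EndTM E M) : E × (E →L[ℝ] E) :=
  mfderiv 𝓘(ℝ, ℝ) (endModel E) c 0 (1 : ℝ)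

theorem hasDerivAt_coord {c : ℝ → EndTM E M}
    (hc : MDifferentiableAt 𝓘(ℝ, ℝ) (endModel E) c 0) :
    HasDerivAt (fun t => (extChartAt 𝓘(ℝ, E) (c 0).1 (c t).1, endCoord (c 0).1 (c t)))
      (velocity c) 0 := by
  have h1 := (mdifferentiableAt_extChartAt_endTM (c 0)).hasMFDerivAt
  rw [mfderiv_extChartAt_endTM] at h1
  let D : ℝ →L[ℝ] E × (E →L[ℝ] E) := mfderiv 𝓘(ℝ, ℝ) (endModel E) c 0
  have h2 : HasFDerivAt (extChartAt (endModel E) (c 0) ∘ c) D 0 :=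
    (h1.comp 0 hc.hasMFDerivAt).hasFDerivAt
  have h3 : (fun t => (extChartAt 𝓘(ℝ, E) (c 0).1 (c t).1, endCoord (c 0).1 (c t))) =
      extChartAt (endModel E) (c 0) ∘ c := by
    ext1 t
    rw [Function.comp, extChartAt_endTM]
  rw [h3]
  exact h2.hasDerivAt

theorem hasDerivAt_of_tangentMap {c : ℝ → EndTM E M} {z : EndTM E M} {X : E} {W : E →L[ℝ] E}
    (hz : c 0 = z) (hc : MDifferentiableAt 𝓘(ℝ, ℝ) (endModel E) c 0)
    (hv : tangentMap 𝓘(ℝ, ℝ) (endModel E) c ⟨0, (1 : ℝ)⟩ = ⟨z, (X, W)⟩) :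
    HasDerivAt (fun t => extChartAt 𝓘(ℝ, E) z.1 (c t).1) X 0 ∧
      HasDerivAt (fun t => endCoord z.1 (c t)) W 0 := by
  subst hz
  have h := hasDerivAt_coord hc
  have hv' : velocity c = (X, W) := eq_of_heq (TotalSpace.mk.inj hv).2
  rw [hv'] at h
  exact ⟨h.fst, h.snd⟩

theorem velocity_eq {c : ℝ → EndTM E M} {z : EndTM E M} {X : E} {W : E →L[ℝ] E}
    (hz : c 0 = z) (hc : MDifferentiableAt 𝓘(ℝ, ℝ) (endModel E) c 0)
    (hX : HasDerivAt (fun t => extChartAt 𝓘(ℝ, E) z.1 (c t).1) X 0)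
    (hW : HasDerivAt (fun t => endCoord z.1 (c t)) W 0) :
    velocity c = (X, W) := by
  subst hz
  exact (hasDerivAt_coord hc).unique (hX.prodMk hW)

/-- The point of `Hom(TM, TM)` with the given coordinates in the chart at `p`. -/
def ofCoord (p : M) (x : E) (A : E →L[ℝ] E) : EndTM E M :=
  ⟨(extChartAt 𝓘(ℝ, E) p).symm x,
    (coframe p ((extChartAt 𝓘(ℝ, E) p).symm x) ∘L A ∘L
      frame p ((extChartAt 𝓘(ℝ, E) p).symm x) : E →L[ℝ] E)⟩

theorem endCoord_ofCoord {p : M} {x : E} (hx : x ∈ (extChartAt 𝓘(ℝ, E) p).target)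
    (A : E →L[ℝ] E) : endCoord p (ofCoord p x A) = A := by
  ext u
  have h := symm_mem_source hx
  calc _ = frame p _ (coframe p _ (A (frame p ((extChartAt 𝓘(ℝ, E) p).symm x)
        (coframe p ((extChartAt 𝓘(ℝ, E) p).symm x) u)))) := rfl
    _ = _ := by rw [frame_coframe h]; exact frame_coframe h _

theorem ofCoord_base (z : EndTM E M) : 
    ofCoord z.1 (extChartAt 𝓘(ℝ, E) z.1 z.1) (endo z) = z := by
  obtain ⟨p, J⟩ := z
  simp only [ofCoord, endo]
  rw [extChartAt_to_inv (I := 𝓘(ℝ, E)) p, frame_self, coframe_self]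
  rfl

theorem contMDiff_ofCoord (p : M) {x : ℝ → E} {A : ℝ → E →L[ℝ] E}
    (hx : ∀ t, x t ∈ (extChartAt 𝓘(ℝ, E) p).target) (hx' : ContDiff ℝ ∞ x) (hA : ContDiff ℝ ∞ A) :
    ContMDiff 𝓘(ℝ, ℝ) (endModel E) ∞ (fun t => ofCoord p (x t) (A t)) := by
  refine (Bundle.Trivialization.contMDiff_iff (e := trivializationAt (E →L[ℝ] E)
    (fun x : M => TangentSpace 𝓘(ℝ, E) x →L[ℝ] TangentSpace 𝓘(ℝ, E) x) p) ?_).2 ⟨?_, ?_⟩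
  · exact fun t => ⟨symm_mem_source (hx t), symm_mem_source (hx t)⟩
  · exact fun t => ((contMDiffOn_extChartAt_symm p).contMDiffAt (target_mem_nhds p (hx t))).comp t
      hx'.contMDiff.contMDiffAt
  · have h : (fun t => endCoord p (ofCoord p (x t) (A t))) = A :=
      funext fun t => endCoord_ofCoord (hx t) (A t)
    change ContMDiff 𝓘(ℝ, ℝ) 𝓘(ℝ, E →L[ℝ] E) ∞ (fun t => endCoord p (ofCoord p (x t) (A t)))
    rw [h]
    exact hA.contMDiff

end Coordinates

/-! ### Orthogonal complex structures on a Euclidean space, and forms invariant under them. -/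

section LinearAlgebra

theorem exists_orthonormal_basis_extending {V : Type*} [NormedAddCommGroup V]
    [InnerProductSpace ℝ V] [FiniteDimensional ℝ V] {m : ℕ} (hV : Module.finrank ℝ V = 2 * m)
    {u v : V} (hu : inner ℝ u u = (1 : ℝ)) (hv : inner ℝ v v = (1 : ℝ))
    (huv : inner ℝ u v = (0 : ℝ)) :
    ∃ b : Module.Basis (Fin m × Fin 2) ℝ V,
      (∀ i j, inner ℝ (b i) (b j) = (if i = j then 1 else 0 : ℝ)) ∧ ∃ k, b (k, 0) = u ∧ b (k, 1) = v := by
  have hm : 0 < m := by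
    rcases Nat.eq_zero_or_pos m with rfl | h
    · have := Module.finrank_zero_iff.1 (hV.trans (by simp))
      rw [Subsingleton.elim u 0] at hu
      simp at hu
    · exact h
  let k : Fin m := ⟨0, hm⟩
  let w : Fin m × Fin 2 → V := fun i => if i.2 = 0 then u else v
  have hw : Orthonormal ℝ (Set.domRestrict ({(k, 0), (k, 1)} : Set (Fin m × Fin 2)) w) := by
    rw [orthonormal_iff_ite]
    have hvu : inner ℝ v u = (0 : ℝ) := by rw [real_inner_comm, huv]
    rintro ⟨i, rfl | rfl⟩ ⟨j, rfl | rfl⟩ <;>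
      simp only [Set.domRestrict_apply, w] <;> simp [hu, hv, huv, hvu,
        -inner_self_eq_norm_sq_to_K, Subtype.ext_iff]
  obtain ⟨b, hb⟩ := hw.exists_orthonormalBasis_extension_of_card_eq
    (by rw [hV]; simp [mul_comm])
  exact ⟨b.toBasis, by simpa using orthonormal_iff_ite.1 b.orthonormal, k, by simpa [w] using hb (k, 0) (by simp), by simpa [w] using hb (k, 1) (by simp)⟩

variable [FiniteDimensional ℝ E]

/-- The form `B` is made the inner product of a second normed structure on `E`, unrelated to the
given norm; the instances are therefore passed by hand. -/
theorem exists_basis_extending {m : ℕ} (hE : Module.finrank ℝ E = 2 * m)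
    {B : E →L[ℝ] E →L[ℝ] ℝ} (hs : ∀ u v, B u v = B v u) (hp : ∀ u, u ≠ 0 → 0 < B u u)
    {u v : E} (hu : B u u = 1) (hv : B v v = 1) (huv : B u v = 0) :
    ∃ b : Module.Basis (Fin m × Fin 2) ℝ E, (∀ i j, B (b i) (b j) = if i = j then 1 else 0) ∧
      ∃ k, b (k, 0) = u ∧ b (k, 1) = v := by
  let c : InnerProductSpace.Core ℝ E :=
    { inner := fun x y => B x y
      conj_inner_symm := fun x y => by simp [hs x y]
      re_inner_nonneg := fun x => by
        rcases eq_or_ne x 0 with rfl | hx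
        · simp
        · exact (hp x hx).le
      add_left := fun x y z => by simp
      smul_left := fun x y r => by simp
      definite := fun x hx => by
        by_contra h
        exact (hp x h).ne' hx }
  have hfd : FiniteDimensional ℝ E := inferInstance
  exact @exists_orthonormal_basis_extending E c.toNormedAddCommGroup
    (InnerProductSpace.ofCore c.toCore) hfd m hE u v hu hv huv

theorem exists_oriented_basis_extending {m : ℕ} (hE : Module.finrank ℝ E = 2 * m)
    {B : E →L[ℝ] E →L[ℝ] ℝ} (hs : ∀ u v, B u v = B v u) (hp : ∀ u, u ≠ 0 → 0 < B u u)
    {u v : E} (hu : B u u = 1) (hv : B v v = 1) (huv : B u v = 0)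
    (o : Orientation ℝ E (Fin m × Fin 2)) :
    ∃ b : Module.Basis (Fin m × Fin 2) ℝ E, (∀ i j, B (b i) (b j) = if i = j then 1 else 0) ∧
      (∃ k, b (k, 0) = u ∧ (b (k, 1) = v ∨ b (k, 1) = -v)) ∧ b.orientation = o := by
  obtain ⟨b, hb, k, h0, h1⟩ := exists_basis_extending hE hs hp hu hv huv
  rcases b.orientation_eq_or_eq_neg o with h | h
  · exact ⟨b, hb, ⟨k, h0, .inl h1⟩, h.symm⟩
  -- Reversing the single vector `v` reverses the orientation and keeps orthonormality; this is the
  -- source of the alternative `±v`.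
  · refine ⟨b.unitsSMul (Function.update 1 (k, 1) (-1)), fun i j => ?_, ⟨k, ?_, .inr ?_⟩, ?_⟩
    · simp only [Module.Basis.unitsSMul_apply, Units.smul_def, map_smul,
        smul_apply, hb, Function.update_apply]
      split_ifs <;> simp_all
    · simp [Module.Basis.unitsSMul_apply, h0]
    · simp [Module.Basis.unitsSMul_apply, h1]
    · rw [Module.Basis.orientation_neg_single, h]

/-- The complex structure with `b (k, 1) = J (b (k, 0))`. -/
theorem exists_complexStructure_of_basis {m : ℕ} {B : E →L[ℝ] E →L[ℝ] ℝ}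
    (b : Module.Basis (Fin m × Fin 2) ℝ E)
    (hb : ∀ i j, B (b i) (b j) = if i = j then 1 else 0) :
    ∃ J : E →L[ℝ] E, (∀ k, b (k, 1) = J (b (k, 0))) ∧ J ∘L J = -.id ℝ E ∧
      ∀ u v, B (J u) (J v) = B u v := by
  let J : E →L[ℝ] E := LinearMap.toContinuousLinearMap
    (b.constr ℝ fun i => if i.2 = 0 then b (i.1, 1) else -b (i.1, 0))
  have h0 : ∀ k, J (b (k, 0)) = b (k, 1) := fun k => b.constr_basis ..
  have h1 : ∀ k, J (b (k, 1)) = -b (k, 0) := fun k => b.constr_basis ..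
  refine ⟨J, fun k => (h0 k).symm, ?_, ?_⟩
  · apply ContinuousLinearMap.coe_injective
    refine b.ext ?_
    rintro ⟨k, i⟩
    fin_cases i
    · simp [h0, h1]
    · simp [h0, h1]
  · have h : (B.bilinearComp J J).toLinearMap₁₂ = B.toLinearMap₁₂ := by
      refine LinearMap.ext_basis b b ?_
      rintro ⟨k, i⟩ ⟨l, j⟩
      fin_cases i <;> fin_cases j <;> simp [h0, h1, hb]
    intro u v
    exact DFunLike.congr_fun (DFunLike.congr_fun h u) v

/-- For a `B`-orthonormal pair with `J u = ±v`, invariance gives `B' u u = B' v v`, and `B' u (J u)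
= B' (J u) (-u)` gives `B' u v = 0`. So `B'` has one length on all `B`-unit vectors that are
orthogonal to a fixed one, and preserves orthogonality; splitting a vector along `e` and its
complement, then polarizing, gives proportionality. -/
theorem proportional_of_invariant {B B' : E →L[ℝ] E →L[ℝ] ℝ} (hs : ∀ u v, B u v = B v u)
    (hp : ∀ u, u ≠ 0 → 0 < B u u) (hs' : ∀ u v, B' u v = B' v u)
    (h : ∀ u v, B u u = 1 → B v v = 1 → B u v = 0 → ∃ J : E →L[ℝ] E, (J u = v ∨ J u = -v) ∧
      J ∘L J = -.id ℝ E ∧ ∀ x y, B' (J x) (J y) = B' x y) (e u v : E) :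
    B' u v * B e e = B' e e * B u v := by
  rcases eq_or_ne e 0 with rfl | he
  · simp
  have hon : ∀ u v, B u u = 1 → B v v = 1 → B u v = 0 → B' u u = B' v v ∧ B' u v = 0 := by
    intro u v hu hv huv
    obtain ⟨J, hJ, hJJ, hB⟩ := h u v hu hv huv
    have hJu : J (J u) = -u := DFunLike.congr_fun hJJ u
    have h1 := hB u u
    have h2 := hB u (J u)
    rw [hJu] at h2
    have h3 := hs' (J u) u
    rcases hJ with hJ | hJ <;> rw [hJ] at h1 h2 h3 <;> simp at h1 h2 h3 <;>
      exact ⟨by linarith, by linarith⟩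
  -- normalization of a vector
  have hnorm : ∀ w, w ≠ 0 → ∃ r : ℝ, 0 < r ∧ r * r * B w w = 1 := by
    intro w hw
    refine ⟨(√(B w w))⁻¹, by have := hp w hw; positivity, ?_⟩
    have h1 := Real.mul_self_sqrt (hp w hw).le
    have h2 : √(B w w) ≠ 0 := (Real.sqrt_pos.2 (hp w hw)).ne'
    field_simp
    nlinarith
  have horth : ∀ x w, B x x = 1 → B x w = 0 → B' x w = 0 ∧ B' w w = B' x x * B w w := by
    intro x w hx hxw
    rcases eq_or_ne w 0 with rfl | hw
    · simp
    obtain ⟨r, hr, hrw⟩ := hnorm w hw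
    obtain ⟨h1, h2⟩ := hon x (r • w) hx (by simpa [mul_assoc] using hrw) (by simp [hxw])
    simp only [map_smul, smul_apply, smul_eq_mul, mul_eq_zero, hr.ne',
      false_or] at h1 h2
    refine ⟨h2, ?_⟩
    rw [h1]
    linear_combination (-B' w w) * hrw
  have hquad : ∀ w, B' w w * B e e = B' e e * B w w := by
    intro w
    obtain ⟨r, hr, hre⟩ := hnorm e he
    set x := r • e with hx
    have hxx : B x x = 1 := by simpa [hx, mul_assoc] using hre
    have hxx' : B' x x = r * r * B' e e := by simp [hx, mul_assoc]
    -- Split `w` into its component along the unit vector `x` and the orthogonal remainder.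
    obtain ⟨h1, h2⟩ := horth x (w - B x w • x) hxx (by simp [hxx])
    have h3 := hs w x
    have h4 := hs' w x
    simp only [map_sub, map_smul, sub_apply, smul_apply,
      smul_eq_mul, hxx, h3, h4] at h1 h2
    have h5 : B' w w = B' x x * B w w := by linear_combination h2 + 2 * (B x w) * h1
    rw [h5, hxx']
    linear_combination (B' e e * B w w) * hre
  have ha := hquad (u + v)
  have h1 := hs u v
  have h2 := hs' u v
  simp only [map_add, add_apply, ← h1, ← h2] at ha
  linear_combination (1 / 2) * ha - (1 / 2) * hquad u - (1 / 2) * hquad v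

end LinearAlgebra

/-! ### Conformal change of the connection and its effect on holomorphy at one point. -/

section PointwiseAlgebra

/-- The relation between the Christoffel symbols of two metrics related by a conformal map with
differential `L`, Hessian `H`, conformal factor `r` and half of the logarithmic differential of the
conformal factor `G a`. -/
theorem christoffel_conformal {G G' : E →L[ℝ] E →L[ℝ] ℝ} {dG dG' : E →L[ℝ] E →L[ℝ] E →L[ℝ] ℝ}
    {L : E →L[ℝ] E} {H Γ Γ' : E →L[ℝ] E →L[ℝ] E} {r : ℝ} {a : E}
    (hG' : ∀ u v, G' u v = G' v u)
    (hp : ∀ u, u ≠ 0 → 0 < G' u u) (hsurj : Function.Surjective L)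
    (hΓ : ∀ X Y Z, G (Γ X Y) Z = (1 / 2) * (dG X Y Z + dG Y X Z - dG Z X Y))
    (hΓ' : ∀ X Y Z, G' (Γ' X Y) Z = (1 / 2) * (dG' X Y Z + dG' Y X Z - dG' Z X Y))
    (hH : ∀ X Y, H X Y = H Y X) (hL : ∀ u v, G' (L u) (L v) = r * G u v)
    (hd : ∀ X u v, dG' (L X) (L u) (L v) + G' (H X u) (L v) + G' (L u) (H X v) =
      r * (2 * G a X * G u v + dG X u v)) (X Y : E) :
    Γ' (L X) (L Y) + H X Y = L (Γ X Y + G a X • Y + G a Y • X - G X Y • a) := by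
  -- Koszul's argument: in the cyclic combination of `hd`, symmetry of `H` cancels every Hessian
  -- term except `H X Y`.
  have key : ∀ Z, G' (Γ' (L X) (L Y) + H X Y -
      L (Γ X Y + G a X • Y + G a Y • X - G X Y • a)) (L Z) = 0 := by
    intro Z
    have h1 := hd X Y Z
    have h2 := hd Y X Z
    have h3 := hd Z X Y
    rw [hH Y X, hG' (L X) (H Y Z)] at h2
    rw [hH Z X, hH Z Y, hG' (L X) (H Y Z)] at h3
    rw [hG' (L Y) (H X Z)] at h1
    have h4 := hΓ X Y Z
    have h5 := hΓ' (L X) (L Y) (L Z)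
    simp only [map_sub, sub_apply, map_add, add_apply, hL, h5, h4, map_smul, smul_apply,
      smul_eq_mul]
    linear_combination (1 / 2) * h1 + (1 / 2) * h2 - (1 / 2) * h3
  obtain ⟨Z, hZ⟩ := hsurj (Γ' (L X) (L Y) + H X Y -
    L (Γ X Y + G a X • Y + G a Y • X - G X Y • a))
  have h := key Z
  rw [hZ] at h
  by_contra hne
  exact (hp _ (sub_ne_zero.2 hne)).ne' h

/-- The change of the connection on endomorphisms under a conformal change of the metric. -/
def conformalTerm (G : E →L[ℝ] E →L[ℝ] ℝ) (a : E) (J : E →L[ℝ] E) (X Y : E) : E :=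
  (G a (J Y) • X - G X (J Y) • a) - J (G a Y • X - G X Y • a)

/-- Only `G (J X) Y = -G X (J Y)` and `J² = -1` are needed. Thus a conformal change never obstructs
holomorphy for `ε = 1`. -/
theorem conformalTerm_holomorphic {G : E →L[ℝ] E →L[ℝ] ℝ} {J : E →L[ℝ] E}
    (hJ : J ∘L J = -.id ℝ E) (hGJ : ∀ u v, G (J u) (J v) = G u v) (a X Y : E) :
    conformalTerm G a J (J X) Y = J (conformalTerm G a J X Y) := by
  have hJJ : ∀ u, J (J u) = -u := fun u => DFunLike.congr_fun hJ u
  have h1 : G (J X) Y = -G X (J Y) := by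
    have := hGJ X (J Y)
    rw [hJJ] at this
    simp only [map_neg] at this
    linarith
  simp only [conformalTerm, map_sub, map_smul, hJJ, hGJ, h1]
  module

/-- The term is also `J`-linear in `X`, so it vanishes. Evaluated at `Y = a` with `X` orthogonal to
`a` and `J a`, it equals `-G a a • J X`. A nonzero such `X` exists from dimension three on; in
dimension two `a` and `J a` already span. -/
theorem eq_zero_of_conformalTerm_antiholomorphic [FiniteDimensional ℝ E]
    (hE : 3 ≤ Module.finrank ℝ E)
    {G : E →L[ℝ] E →L[ℝ] ℝ} {J : E →L[ℝ] E} (hG : ∀ u v, G u v = G v u)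
    (hp : ∀ u, u ≠ 0 → 0 < G u u)
    (hJ : J ∘L J = -.id ℝ E) (hGJ : ∀ u v, G (J u) (J v) = G u v) (a : E)
    (h : ∀ X Y, conformalTerm G a J (J X) Y = -J (conformalTerm G a J X Y)) : a = 0 := by
  have hJJ : ∀ u, J (J u) = -u := fun u => DFunLike.congr_fun hJ u
  have h0 : ∀ X Y, conformalTerm G a J X Y = 0 := by
    intro X Y
    have h1 := h X Y
    rw [conformalTerm_holomorphic hJ hGJ, eq_neg_iff_add_eq_zero, ← two_smul ℝ,
      smul_eq_zero_iff_right two_ne_zero] at h1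
    have h2 := hJJ (conformalTerm G a J X Y)
    rw [h1, map_zero] at h2
    exact neg_eq_zero.1 h2.symm
  by_contra ha
  -- a vector orthogonal to `a` and `J a`
  obtain ⟨X, hX, hX0⟩ : ∃ X, (G a X = 0 ∧ G (J a) X = 0) ∧ X ≠ 0 := by
    let f : E →ₗ[ℝ] ℝ × ℝ := (G a).toLinearMap.prod (G (J a)).toLinearMap
    have hf : LinearMap.ker f ≠ ⊥ := LinearMap.ker_ne_bot_of_finrank_lt (by simp; omega)
    obtain ⟨X, hX, hX0⟩ := Submodule.exists_mem_ne_zero_of_ne_bot hf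
    refine ⟨X, ?_, hX0⟩
    simpa [f] using hX
  have h1 := congrArg (G (J X)) (h0 X a)
  have h2 : G a (J a) = 0 := by
    have := hGJ a (J a)
    rw [hJJ, map_neg, hG] at this
    linarith
  simp only [conformalTerm, h2, hG X (J a), hX.2, hG X a, hX.1, zero_smul, sub_zero, zero_sub,
    map_smul, map_neg, smul_eq_mul, map_zero, neg_eq_zero, mul_eq_zero, hGJ] at h1
  rcases h1 with h1 | h1
  · exact (hp a ha).ne' h1
  · exact (hp X hX0).ne' h1

/-- The pointwise form of holomorphicity. -/
theorem holomorphic_iff_conformalTerm {G : E →L[ℝ] E →L[ℝ] ℝ} {L J J' : E →L[ℝ] E}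
    {H Γ Γ' : E →L[ℝ] E →L[ℝ] E} {a : E} (hbij : Function.Bijective L)
    (hJL : ∀ u, J' (L u) = L (J u))
    (hΓ : ∀ X Y, Γ' (L X) (L Y) + H X Y = L (Γ X Y + G a X • Y + G a Y • X - G X Y • a))
    (ε : ℝ) {X : E} {W V V₂ : E →L[ℝ] E}
    (hV : ∀ u, V (L u) = L (W u) + H X (J u) - J' (H X u))
    (hV₂ : ∀ u, V₂ (L u) =
      L ((ε • (J ∘L (W + (Γ X ∘L J - J ∘L Γ X))) - (Γ (J X) ∘L J - J ∘L Γ (J X))) u) +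
        H (J X) (J u) - J' (H (J X) u)) :
    V₂ = ε • (J' ∘L (V + (Γ' (L X) ∘L J' - J' ∘L Γ' (L X)))) -
        (Γ' (J' (L X)) ∘L J' - J' ∘L Γ' (J' (L X))) ↔
      ∀ Y, conformalTerm G a J (J X) Y = ε • J (conformalTerm G a J X Y) := by
  have hΓ2 : ∀ X Y, Γ' (L X) (L Y) = L (Γ X Y + G a X • Y + G a Y • X - G X Y • a) - H X Y :=
    fun X Y => eq_sub_of_add_eq (hΓ X Y)
  -- The Hessian terms of `V` and `V₂` cancel those of `Γ'`. The scalar part `G a X • Y` of the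
  -- conformal change commutes with `J` and drops out of the bracket.
  have key : ∀ u, V₂ (L u) - (ε • (J' ∘L (V + (Γ' (L X) ∘L J' - J' ∘L Γ' (L X)))) -
        (Γ' (J' (L X)) ∘L J' - J' ∘L Γ' (J' (L X)))) (L u) =
      L (conformalTerm G a J (J X) u - ε • J (conformalTerm G a J X u)) := by
    intro u
    simp only [conformalTerm, hV₂, hV, hJL, hΓ2, map_sub, map_add, map_smul, sub_apply, add_apply,
      smul_apply, ContinuousLinearMap.comp_apply]
    module
  constructor
  · intro h Y
    have h1 := key Y
    rw [h, sub_self] at h1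
    have h2 := hbij.1 (h1.symm.trans (map_zero L).symm)
    exact sub_eq_zero.1 h2
  · intro h
    ext w
    obtain ⟨u, rfl⟩ := hbij.2 w
    rw [← sub_eq_zero, key, h, sub_self, map_zero]

end PointwiseAlgebra

/-! ### A diffeomorphism in charts: its differential, conjugation, and pulled-back metrics. -/

section LocalMap

variable {M : Type*} [TopologicalSpace M] [ChartedSpace E M] [IsManifold 𝓘(ℝ, E) ∞ M]
  {M' : Type*} [TopologicalSpace M'] [ChartedSpace E M'] [IsManifold 𝓘(ℝ, E) ∞ M']

/-- The differential of a map, as an endomorphism of the model space. -/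
def differential (φ : M → M') (q : M) : E →L[ℝ] E := mfderiv 𝓘(ℝ, E) 𝓘(ℝ, E) φ q

/-- A map in the charts at `p` and `φ p`. -/
def localMap (φ : M → M') (p : M) (x : E) : E :=
  extChartAt 𝓘(ℝ, E) (φ p) (φ ((extChartAt 𝓘(ℝ, E) p).symm x))

theorem localMap_base (φ : M → M') (p : M) :
    localMap φ p (extChartAt 𝓘(ℝ, E) p p) = extChartAt 𝓘(ℝ, E) (φ p) (φ p) := by
  rw [localMap, extChartAt_to_inv]

theorem extChartAt_mem_target {p q : M} (hq : q ∈ (chartAt E p).source) :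
    extChartAt 𝓘(ℝ, E) p q ∈ (extChartAt 𝓘(ℝ, E) p).target :=
  (extChartAt 𝓘(ℝ, E) p).map_source (by simpa using hq)

theorem symm_extChartAt {p q : M} (hq : q ∈ (chartAt E p).source) :
    (extChartAt 𝓘(ℝ, E) p).symm (extChartAt 𝓘(ℝ, E) p q) = q :=
  (extChartAt 𝓘(ℝ, E) p).left_inv (by simpa using hq)

theorem contDiffAt_localMap {φ : M → M'} (hφ : ContMDiff 𝓘(ℝ, E) 𝓘(ℝ, E) ∞ φ) {p q : M}
    (hq : q ∈ (chartAt E p).source) (hq' : φ q ∈ (chartAt E (φ p)).source) :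
    ContDiffAt ℝ ∞ (localMap φ p) (extChartAt 𝓘(ℝ, E) p q) := by
  refine ContMDiffAt.contDiffAt ?_
  have h1 := (contMDiffOn_extChartAt_symm (I := 𝓘(ℝ, E)) (n := ∞) p).contMDiffAt
    (target_mem_nhds p (extChartAt_mem_target hq))
  refine ContMDiffAt.comp (I' := 𝓘(ℝ, E)) _ ?_ (ContMDiffAt.comp (I' := 𝓘(ℝ, E)) _ ?_ h1)
  · rw [symm_extChartAt hq]
    exact contMDiffAt_extChartAt' hq'
  · exact hφ.contMDiffAt

theorem fderiv_localMap {φ : M → M'} (hφ : ContMDiff 𝓘(ℝ, E) 𝓘(ℝ, E) ∞ φ) {p q : M}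
    (hq : q ∈ (chartAt E p).source) (hq' : φ q ∈ (chartAt E (φ p)).source) :
    fderiv ℝ (localMap φ p) (extChartAt 𝓘(ℝ, E) p q) =
      frame (φ p) (φ q) ∘L differential φ q ∘L coframe p q := by
  have h1 : MDifferentiableAt 𝓘(ℝ, E) 𝓘(ℝ, E) (extChartAt 𝓘(ℝ, E) p).symm
      (extChartAt 𝓘(ℝ, E) p q) :=
    ((contMDiffOn_extChartAt_symm (I := 𝓘(ℝ, E)) (n := ∞) p).contMDiffAt
    (target_mem_nhds p (extChartAt_mem_target hq))).mdifferentiableAt (by simp)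
  have h2 : MDifferentiableAt 𝓘(ℝ, E) 𝓘(ℝ, E) φ
      ((extChartAt 𝓘(ℝ, E) p).symm (extChartAt 𝓘(ℝ, E) p q)) :=
    hφ.contMDiffAt.mdifferentiableAt (by simp)
  have h3 : MDifferentiableAt 𝓘(ℝ, E) 𝓘(ℝ, E) (extChartAt 𝓘(ℝ, E) (φ p))
      (φ ((extChartAt 𝓘(ℝ, E) p).symm (extChartAt 𝓘(ℝ, E) p q))) := by
    rw [symm_extChartAt hq]
    exact mdifferentiableAt_extChartAt hq'
  have h4 := HasMFDerivAt.comp (f := φ ∘ (extChartAt 𝓘(ℝ, E) p).symm) _ h3.hasMFDerivAt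
    (h2.hasMFDerivAt.comp _ h1.hasMFDerivAt)
  rw [← coframe_eq_mfderiv hq, symm_extChartAt hq, ← frame_eq_mfderiv hq'] at h4
  have h5 : HasFDerivAt (localMap φ p) (frame (φ p) (φ q) ∘L differential φ q ∘L coframe p q)
      (extChartAt 𝓘(ℝ, E) p q) := h4.hasFDerivAt
  exact h5.fderiv

theorem fderiv_localMap_base {φ : M → M'} (hφ : ContMDiff 𝓘(ℝ, E) 𝓘(ℝ, E) ∞ φ) (p : M) :
    fderiv ℝ (localMap φ p) (extChartAt 𝓘(ℝ, E) p p) = differential φ p := by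
  rw [fderiv_localMap hφ (mem_chart_source E p) (mem_chart_source E (φ p)), frame_self,
    coframe_self]
  rfl

/-- Points near `p` where the local representation of `φ` is valid. -/
theorem eventually_mem_source {φ : M → M'} (hφ : Continuous φ) (p : M) :
    ∀ᶠ q in 𝓝 p, q ∈ (chartAt E p).source ∧ φ q ∈ (chartAt E (φ p)).source :=
  ((chartAt E p).open_source.eventually_mem (mem_chart_source E p)).and
    (hφ.continuousAt.eventually
      ((chartAt E (φ p)).open_source.eventually_mem (mem_chart_source E (φ p))))

theorem differential_bijective (φ : M ≃ₘ^∞⟮𝓘(ℝ, E), 𝓘(ℝ, E)⟯ M') (q : M) :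
    Function.Bijective (differential (E := E) φ q) :=
  (φ.mfderivToContinuousLinearEquiv (by simp) q).bijective

theorem endo_conjugate (φ : M ≃ₘ^∞⟮𝓘(ℝ, E), 𝓘(ℝ, E)⟯ M') (w : EndTM E M) (u : E) :
    endo (conjugate φ w) (differential φ w.1 u) = differential φ w.1 (endo w u) :=
  congrArg (fun x => differential φ w.1 (endo w x))
    ((φ.mfderivToContinuousLinearEquiv (by simp) w.1).symm_apply_apply u)

theorem eq_conjugate {φ : M ≃ₘ^∞⟮𝓘(ℝ, E), 𝓘(ℝ, E)⟯ M'} {w : EndTM E M} {w' : EndTM E M'}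
    (h : w'.1 = φ w.1)
    (h' : ∀ u, endo w' (differential φ w.1 u) = differential φ w.1 (endo w u)) :
    w' = conjugate φ w := by
  obtain ⟨q, A⟩ := w'
  obtain rfl : q = φ w.1 := h
  have h2 : endo (⟨φ w.1, A⟩ : EndTM E M') = endo (conjugate φ w) := by
    ext u
    obtain ⟨u, rfl⟩ := (differential_bijective φ w.1).2 u
    rw [h', endo_conjugate]
  exact congrArg (TotalSpace.mk (φ w.1)) h2

theorem endCoord_conjugate (φ : M ≃ₘ^∞⟮𝓘(ℝ, E), 𝓘(ℝ, E)⟯ M') {p : M} (w : EndTM E M)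
    (hq : w.1 ∈ (chartAt E p).source) (hq' : φ w.1 ∈ (chartAt E (φ p)).source) (u : E) :
    endCoord (φ p) (conjugate φ w)
        (fderiv ℝ (localMap φ p) (extChartAt 𝓘(ℝ, E) p w.1) u) =
      fderiv ℝ (localMap φ p) (extChartAt 𝓘(ℝ, E) p w.1) (endCoord p w u) := by
  rw [fderiv_localMap φ.contMDiff hq hq', endCoord_eq, endCoord_eq]
  change frame (φ p) (φ w.1) (endo (conjugate φ w) (coframe (φ p) (φ w.1) (frame (φ p) (φ w.1)
    (differential φ w.1 (coframe p w.1 u))))) = frame (φ p) (φ w.1) (differential φ w.1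
      (coframe p w.1 (frame p w.1 (endo w (coframe p w.1 u)))))
  rw [coframe_frame hq', coframe_frame hq, endo_conjugate]

theorem localMetric_localMap {φ : M → M'} (hφ : ContMDiff 𝓘(ℝ, E) 𝓘(ℝ, E) ∞ φ)
    {g' : Metric E M'}
    {p q : M} (hq : q ∈ (chartAt E p).source) (hq' : φ q ∈ (chartAt E (φ p)).source) (u v : E) :
    localMetric g' (φ p) (localMap φ p (extChartAt 𝓘(ℝ, E) p q))
      (fderiv ℝ (localMap φ p) (extChartAt 𝓘(ℝ, E) p q) u)
      (fderiv ℝ (localMap φ p) (extChartAt 𝓘(ℝ, E) p q) v) =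
    form g' (φ q) (differential φ q (coframe p q u)) (differential φ q (coframe p q v)) := by
  rw [fderiv_localMap hφ hq hq', localMetric, localMap, symm_extChartAt hq, symm_extChartAt hq',
    metricCoord_apply g' hq']
  simp only [ContinuousLinearMap.comp_apply, coframe_frame hq']

theorem localMetric_extChartAt (g : Metric E M) {p q : M} (hq : q ∈ (chartAt E p).source)
    (u v : E) : localMetric g p (extChartAt 𝓘(ℝ, E) p q) u v =
      form g q (coframe p q u) (coframe p q v) := by
  rw [localMetric, symm_extChartAt hq, metricCoord_apply g hq]

theorem eventually_extChartAt {P : E → Prop} {p : M}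
    (h : ∀ᶠ q in 𝓝 p, P (extChartAt 𝓘(ℝ, E) p q)) :
    ∀ᶠ x in 𝓝 (extChartAt 𝓘(ℝ, E) p p), P x := by
  have h1 : ContinuousAt (extChartAt 𝓘(ℝ, E) p).symm (extChartAt 𝓘(ℝ, E) p p) :=
    continuousAt_extChartAt_symm p
  have h2 := h1.tendsto.eventually (by rwa [extChartAt_to_inv])
  filter_upwards [h2, target_mem_nhds p (base_mem_target p)] with x hx hx'
  rwa [(extChartAt 𝓘(ℝ, E) p).right_inv hx'] at hx

/-- The first derivatives of the metrics at `p` if `φ^* g' = e^{2f} g`. -/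
theorem metricDeriv_conformal {φ : M → M'} (hφ : ContMDiff 𝓘(ℝ, E) 𝓘(ℝ, E) ∞ φ)
    {g : Metric E M} {g' : Metric E M'} {f : M → ℝ} (hf : ContMDiff 𝓘(ℝ, E) 𝓘(ℝ, ℝ) ∞ f)
    (h : ∀ q u v, form g' (φ q) (differential φ q u) (differential φ q v) =
      Real.exp (2 * f q) * form g q u v) (p : M) (X u v : E) :
    let L := differential φ p
    let H := fderiv ℝ (fderiv ℝ (localMap φ p)) (extChartAt 𝓘(ℝ, E) p p)
    metricDeriv g' (φ p) (L X) (L u) (L v) + form g' (φ p) (H X u) (L v) +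
        form g' (φ p) (L u) (H X v) =
      Real.exp (2 * f p) *
        (2 * fderiv ℝ (f ∘ (extChartAt 𝓘(ℝ, E) p).symm) (extChartAt 𝓘(ℝ, E) p p) X *
          form g p u v + metricDeriv g p X u v) := by
  intro L H
  set x₀ := extChartAt 𝓘(ℝ, E) p p with hx₀
  have hψ : ContDiffAt ℝ ∞ (localMap φ p) x₀ :=
    contDiffAt_localMap hφ (mem_chart_source E p) (mem_chart_source E (φ p))
  have hψ1 : HasFDerivAt (localMap φ p) L x₀ := by
    have := (hψ.differentiableAt (by simp)).hasFDerivAt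
    rwa [fderiv_localMap_base hφ] at this
  have hψ2 : HasFDerivAt (fderiv ℝ (localMap φ p)) H x₀ :=
    ((hψ.fderiv_right (m := ∞) le_rfl).differentiableAt (by simp)).hasFDerivAt
  have hL : fderiv ℝ (localMap φ p) x₀ = L := fderiv_localMap_base hφ p
  have hG : HasFDerivAt (localMetric g p) (metricDeriv g p) x₀ := by
    rw [metricDeriv_eq]
    exact ((contDiffAt_localMetric g p (base_mem_target p)).differentiableAt
      (by simp)).hasFDerivAt
  have hG' : HasFDerivAt (localMetric g' (φ p)) (metricDeriv g' (φ p)) (localMap φ p x₀) := by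
    rw [metricDeriv_eq, localMap_base]
    exact ((contDiffAt_localMetric g' (φ p) (base_mem_target (φ p))).differentiableAt
      (by simp)).hasFDerivAt
  have hfl : HasFDerivAt (f ∘ (extChartAt 𝓘(ℝ, E) p).symm)
      (fderiv ℝ (f ∘ (extChartAt 𝓘(ℝ, E) p).symm) x₀) x₀ := by
    refine DifferentiableAt.hasFDerivAt ?_
    refine ContDiffAt.differentiableAt (n := ∞) (ContMDiffAt.contDiffAt ?_) (by simp)
    exact ContMDiffAt.comp (I' := 𝓘(ℝ, E)) x₀ hf.contMDiffAt
      ((contMDiffOn_extChartAt_symm p).contMDiffAt (target_mem_nhds p (base_mem_target p)))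
  -- `h1` and `h2` differentiate the two sides of the conformality identity, written in the charts
  -- with `u` and `v` constant.
  have h1 := ((hG'.comp x₀ hψ1).clm_apply (hψ2.clm_apply (hasFDerivAt_const u x₀))).clm_apply
    (hψ2.clm_apply (hasFDerivAt_const v x₀))
  have h2 := ((hfl.const_mul 2).exp).mul
    ((hG.clm_apply (hasFDerivAt_const u x₀)).clm_apply (hasFDerivAt_const v x₀))
  have heq : (fun x => localMetric g' (φ p) (localMap φ p x) (fderiv ℝ (localMap φ p) x u)
      (fderiv ℝ (localMap φ p) x v)) =ᶠ[𝓝 x₀]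
      fun x => Real.exp (2 * (f ∘ (extChartAt 𝓘(ℝ, E) p).symm) x) * localMetric g p x u v := by
    refine eventually_extChartAt ?_
    filter_upwards [eventually_mem_source (E := E) hφ.continuous p] with q hq
    rw [localMetric_localMap (E := E) (g' := g') hφ hq.1 hq.2, h, localMetric_extChartAt g hq.1,
      Function.comp, symm_extChartAt hq.1]
  have h3 := DFunLike.congr_fun ((h2.congr_of_eventuallyEq heq).unique h1) X
  have hb' : localMetric g' (φ p) (localMap φ p x₀) = form g' (φ p) := by
    rw [localMap_base, localMetric_base]
  have hb : localMetric g p x₀ = form g p := localMetric_base g p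
  have hf0 : f ((extChartAt 𝓘(ℝ, E) p).symm x₀) = f p := by rw [hx₀, extChartAt_to_inv]
  simp only [ContinuousLinearMap.flip_apply, ContinuousLinearMap.comp_apply, add_apply,
    ContinuousLinearMap.comp_zero, zero_add, smul_apply, smul_eq_mul, Function.comp_apply, hf0, hb,
    hb', hL] at h3
  simp at h3
  simp only [mfld_simps] at h3 ⊢
  linear_combination -h3

end LocalMap

/-! ### Square roots near the identity. -/

section SquareRoot

/-- The local inverse near `1` of the squaring map of a Banach algebra. -/
theorem exists_local_sqrt (R : Type*) [NormedRing R] [NormedAlgebra ℝ R] [CompleteSpace R] :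
    ∃ r : R → R, r 1 = 1 ∧ (∀ᶠ y in 𝓝 (1 : R), ContDiffAt ℝ ∞ r y) ∧
      (∀ᶠ y in 𝓝 (1 : R), r y * r y = y) ∧ ∀ᶠ x in 𝓝 (1 : R), r (x * x) = x := by
  let e : R ≃L[ℝ] R := ContinuousLinearEquiv.smulLeft (Units.mk0 (2 : ℝ) two_ne_zero)
  have hf : ContDiffAt ℝ ω (fun x : R => x * x) 1 := contDiffAt_id.mul contDiffAt_id
  have hf' : HasFDerivAt (fun x : R => x * x) (e : R →L[ℝ] R) 1 := by
    have h := (hasFDerivAt_id (𝕜 := ℝ) (1 : R)).mul' (hasFDerivAt_id (1 : R))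
    refine h.congr_fderiv ?_
    ext x
    simp [e, two_smul, Units.smul_def]
  have hs := hf.hasStrictFDerivAt' hf' (by simp)
  refine ⟨hf.localInverse hf' (by simp), ?_, ?_, ?_, hs.eventually_left_inverse⟩
  · simpa using hf.localInverse_apply_image hf' (by simp)
  · have h := (hf.to_localInverse hf' (by simp)).eventually (by simp)
    rw [mul_one] at h
    exact h.mono fun y hy => hy.of_le (by simp)
  · have h := hs.eventually_right_inverse
    rwa [mul_one] at h

end SquareRoot

/-! ### Deforming an orthogonal complex structure along a varying metric. -/

section Adjoint

variable [FiniteDimensional ℝ E]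

/-- The endomorphism `N` with `G (N u) v = H u v`. -/
def raise (G : E →L[ℝ] E →L[ℝ] ℝ) (H : E →L[ℝ] E →L[ℝ] ℝ) : E →L[ℝ] E := G.inverse ∘L H

theorem raise_apply {G : E →L[ℝ] E →L[ℝ] ℝ} (hG : G.IsInvertible) (H : E →L[ℝ] E →L[ℝ] ℝ)
    (u v : E) : G (raise G H u) v = H u v :=
  DFunLike.congr_fun (hG.self_apply_inverse (H u)) v

theorem eq_of_form_eq {G : E →L[ℝ] E →L[ℝ] ℝ} (hG : G.IsInvertible) {u v : E}
    (h : ∀ w, G u w = G v w) : u = v :=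
  hG.injective (ContinuousLinearMap.ext h)

/-- The adjoint of an endomorphism with respect to a bilinear form. -/
def adj (G : E →L[ℝ] E →L[ℝ] ℝ) (S : E →L[ℝ] E) : E →L[ℝ] E :=
  raise G ((ContinuousLinearMap.compL ℝ E E ℝ).flip S ∘L G)

theorem adj_apply {G : E →L[ℝ] E →L[ℝ] ℝ} (hG : G.IsInvertible) (S : E →L[ℝ] E) (u v : E) :
    G (adj G S u) v = G u (S v) := by
  rw [adj, raise_apply hG]
  rfl

theorem continuous_adj (G : E →L[ℝ] E →L[ℝ] ℝ) : Continuous (adj G) := by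
  unfold adj raise
  fun_prop

/-- The square root of an endomorphism that is symmetric for `G` is symmetric. -/
theorem eventually_sqrt_symm {G : E →L[ℝ] E →L[ℝ] ℝ} (hG : G.IsInvertible)
    {r : (E →L[ℝ] E) → (E →L[ℝ] E)} (h1 : r 1 = 1)
    (hr : ContinuousAt r 1) (hr1 : ∀ᶠ y in 𝓝 1, r y * r y = y)
    (hr2 : ∀ᶠ x in 𝓝 1, r (x * x) = x) :
    ∀ᶠ N in 𝓝 (1 : E →L[ℝ] E), (∀ u v, G (N u) v = G u (N v)) →
      ∀ u v, G (r N u) v = G u (r N v) := by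
  have hadj1 : adj G 1 = 1 := by
    ext u
    exact eq_of_form_eq hG fun w => adj_apply hG 1 u w
  have ht : Filter.Tendsto (fun N => adj G (r N)) (𝓝 1) (𝓝 1) := by
    have := ((continuous_adj G).continuousAt.comp hr).tendsto
    rwa [Function.comp_apply, h1, hadj1] at this
  filter_upwards [hr1, ht.eventually hr2] with N hN1 hN2 hsym
  -- The adjoint of the root is another root of `N` close to `1`, so local uniqueness makes the two
  -- equal.
  have h : adj G (r N) * adj G (r N) = N := by
    ext u
    refine eq_of_form_eq hG fun w => ?_
    change G (adj G (r N) (adj G (r N) u)) w = _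
    rw [adj_apply hG, adj_apply hG, hsym]
    conv_rhs => rw [← hN1]
    rfl
  rw [h] at hN2
  intro u v
  conv_lhs => rw [hN2]
  exact adj_apply hG _ u v

theorem det_pos_of_near_one : ∀ᶠ Q in 𝓝 (1 : E →L[ℝ] E), 0 < LinearMap.det Q.toLinearMap := by
  have h : Continuous fun Q : E →L[ℝ] E => Q.det := ContinuousLinearMap.continuous_det
  have h1 : (0 : ℝ) < (1 : E →L[ℝ] E).det := by simp [ContinuousLinearMap.det]
  exact h.continuousAt.eventually (lt_mem_nhds h1)

theorem hasDerivAt_ringInverse {R : Type*} [NormedRing R] [NormedAlgebra ℝ R] [CompleteSpace R]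
    {c : ℝ → R} {c' : R} (h0 : c 0 = 1) (h : HasDerivAt c c' 0) :
    HasDerivAt (fun t => Ring.inverse (c t)) (-c') 0 := by
  have h1 := hasFDerivAt_ringInverse (𝕜 := ℝ) (1 : Rˣ)
  rw [Units.val_one, ← h0] at h1
  exact (h1.comp_hasDerivAt 0 h).congr_deriv (by simp)

/-- The derivative of the curve of complex structures in `exists_deformation`. -/
theorem deformation_velocity {G : E →L[ℝ] E →L[ℝ] ℝ} {dG : E →L[ℝ] E →L[ℝ] ℝ}
    (hG : G.IsInvertible) {J W N' R' : E →L[ℝ] E} (hJ : J * J = -1)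
    (hGJ : ∀ u v, G (J u) (J v) = G u v) (hW : W * J + J * W = 0)
    (hGW : ∀ u v, dG (J u) (J v) + G (W u) (J v) + G (J u) (W v) = dG u v)
    (hN : ∀ u v, G (N' u) v =
      dG u v + G (((1 / 2 : ℝ) • (J * W)) u) v + G u (((1 / 2 : ℝ) • (J * W)) v))
    (hR : R' + R' = N') :
    ((1 / 2 : ℝ) • (J * W) - R') * J + J * (R' - (1 / 2 : ℝ) • (J * W)) = W := by
  have hJJ : ∀ u, J (J u) = -u := fun u => DFunLike.congr_fun hJ u
  have hWJ : ∀ u, W (J u) = -J (W u) := fun u =>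
    eq_neg_of_add_eq_zero_left (DFunLike.congr_fun hW u)
  -- The linearized orthogonality `hGW` says exactly that the form defining `N'` is `J`-invariant.
  -- So `R'` commutes with `J` and does not contribute to the velocity, while `[½ J W, J] = W`.
  have hcomm : N' * J = J * N' := by
    ext u
    refine eq_of_form_eq hG fun v => ?_
    change G (N' (J u)) v = G (J (N' u)) v
    have h1 : G (J (N' u)) v = -G (N' u) (J v) := by
      have := hGJ (N' u) (J v)
      rw [hJJ, map_neg] at this
      linarith
    have h2 := hGW u (J v)
    have h3 : ∀ u v, G (J u) v = -G u (J v) := by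
      intro u v
      have := hGJ u (J v)
      rw [hJJ, map_neg] at this
      linarith
    rw [h1, hN, hN]
    simp only [smul_apply, mul_apply_eq_comp, map_smul, hJJ, hWJ, map_neg, smul_eq_mul,
      hGJ, neg_apply, h3] at h2 ⊢
    linarith
  have hR2 : R' = (1 / 2 : ℝ) • N' := by rw [← hR, ← two_smul ℝ, smul_smul]; norm_num
  have hJW : J * W * J = W := by
    ext u
    simp [hJJ, hWJ]
  have hJJW : J * (J * W) = -W := by rw [← mul_assoc, hJ, neg_one_mul]
  rw [hR2, sub_mul, mul_sub, smul_mul_assoc, smul_mul_assoc, mul_smul_comm, mul_smul_comm, hcomm,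
    hJW, hJJW]
  module

/-- Conjugating `J` by `B t = 1 + t S` with `S = ½ J W` produces the velocity `W`, but `B t` is not
an isometry between the metrics at `x₀` and `x₀ + t X`. The polar decomposition repairs this: if `N
t` represents the pullback by `B t` of the metric at `x₀ + t X`, then `Q t = B t * (N t)^(-1/2)` is
an isometry, and `A t = Q t * J * (Q t)⁻¹` is the curve. The velocity survives by
`deformation_velocity`. The clause on `det Q` is kept for orientations. -/
theorem exists_deformation {G : E → E →L[ℝ] E →L[ℝ] ℝ} {x₀ X : E}
    (hsm : ∀ᶠ x in 𝓝 x₀, ContDiffAt ℝ ∞ G x) (hs : ∀ᶠ x in 𝓝 x₀, ∀ u v, G x u v = G x v u)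
    (hG : (G x₀).IsInvertible) {J W : E →L[ℝ] E} (hJ : J * J = -1)
    (hGJ : ∀ u v, G x₀ (J u) (J v) = G x₀ u v) (hW : W * J + J * W = 0)
    (hGW : ∀ u v, fderiv ℝ G x₀ X (J u) (J v) + G x₀ (W u) (J v) + G x₀ (J u) (W v) =
      fderiv ℝ G x₀ X u v) :
    ∃ A : ℝ → E →L[ℝ] E, A 0 = J ∧ HasDerivAt A W 0 ∧ ∀ᶠ t in 𝓝 (0 : ℝ),
      ContDiffAt ℝ ∞ A t ∧ A t * A t = -1 ∧
      (∀ u v, G (x₀ + t • X) (A t u) (A t v) = G (x₀ + t • X) u v) ∧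
      ∃ Q : (E →L[ℝ] E)ˣ, 0 < LinearMap.det (Q : E →L[ℝ] E).toLinearMap ∧
        A t = Q * J * (Q⁻¹ : (E →L[ℝ] E)ˣ) := by
  have : CompleteSpace E := FiniteDimensional.complete ℝ E
  obtain ⟨r, hr1, hrsm, hrsq, hrinv⟩ := exists_local_sqrt (E →L[ℝ] E)
  set S : E →L[ℝ] E := (1 / 2 : ℝ) • (J * W) with hS
  let x : ℝ → E := fun t => x₀ + t • X
  let B : ℝ → E →L[ℝ] E := fun t => 1 + t • S
  let H : ℝ → E →L[ℝ] E →L[ℝ] ℝ := fun t =>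
    ((ContinuousLinearMap.compL ℝ E E ℝ).flip (B t)) ∘L G (x t) ∘L B t
  let N : ℝ → E →L[ℝ] E := fun t => raise (G x₀) (H t)
  let R : ℝ → E →L[ℝ] E := fun t => r (N t)
  let Q : ℝ → E →L[ℝ] E := fun t => B t * Ring.inverse (R t)
  let A : ℝ → E →L[ℝ] E := fun t => Q t * J * (R t * Ring.inverse (B t))
  have hx : ContDiff ℝ ∞ x := by fun_prop
  have hB : ContDiff ℝ ∞ B := by fun_prop
  have hx0 : x 0 = x₀ := by simp [x]
  have hB0 : B 0 = 1 := by simp [B]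
  have hNsm : ∀ t, ContDiffAt ℝ ∞ G (x t) → ContDiffAt ℝ ∞ N t := by
    intro t ht
    have h1 : ContDiffAt ℝ ∞ (fun t => G (x t)) t := ht.comp t hx.contDiffAt
    have h2 : ContDiffAt ℝ ∞ (fun t => (ContinuousLinearMap.compL ℝ E E ℝ).flip (B t)) t :=
      ((ContinuousLinearMap.compL ℝ E E ℝ).flip.contDiff.comp hB).contDiffAt
    exact contDiffAt_const.clm_comp (h2.clm_comp (h1.clm_comp hB.contDiffAt))
  have hN : ∀ t u v, G x₀ (N t u) v = G (x t) (B t u) (B t v) := fun t u v => raise_apply hG _ u v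
  have hN0 : N 0 = 1 := by
    ext u
    refine eq_of_form_eq hG fun v => ?_
    rw [hN, hx0, hB0]
    rfl
  have hR0 : R 0 = 1 := by simp only [R, hN0, hr1]
  have hxt : Filter.Tendsto x (𝓝 0) (𝓝 x₀) := hx0 ▸ hx.continuous.continuousAt.tendsto
  have hN0sm : ContDiffAt ℝ ∞ N 0 := hNsm 0 (by rw [hx0]; exact hsm.self_of_nhds)
  have hNt : Filter.Tendsto N (𝓝 0) (𝓝 1) := hN0 ▸ hN0sm.continuousAt.tendsto
  have hR0sm : ContDiffAt ℝ ∞ R 0 :=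
    ContDiffAt.comp 0 (by rw [hN0]; exact hrsm.self_of_nhds) hN0sm
  have hRt : Filter.Tendsto R (𝓝 0) (𝓝 1) := hR0 ▸ hR0sm.continuousAt.tendsto
  have hBt : Filter.Tendsto B (𝓝 0) (𝓝 1) := hB0 ▸ hB.continuous.continuousAt.tendsto
  have hunit : ∀ᶠ y in 𝓝 (1 : E →L[ℝ] E), IsUnit y := Units.isOpen.mem_nhds isUnit_one
  have hB' : HasDerivAt B S 0 := by
    simpa [B] using ((hasDerivAt_id (0 : ℝ)).smul_const S).const_add 1
  have hN' := (hN0sm.differentiableAt (by simp)).hasDerivAt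
  have hR' := (hR0sm.differentiableAt (by simp)).hasDerivAt
  have hRi' := hasDerivAt_ringInverse hR0 hR'
  have hBi' := hasDerivAt_ringInverse hB0 hB'
  have hQ' := hB'.mul hRi'
  have hQ0 : Q 0 = 1 := by simp [Q, hB0, hR0]
  have hQt : Filter.Tendsto Q (𝓝 0) (𝓝 1) := hQ0 ▸ hQ'.continuousAt.tendsto
  have hA' := (hQ'.mul_const J).mul (hR'.mul hBi')
  -- Differentiate `R * R = N` at `R 0 = 1`.
  have hRN : deriv R 0 + deriv R 0 = deriv N 0 := by
    have h1 := hR'.mul hR'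
    have h2 : (R * R) =ᶠ[𝓝 0] N := hNt.eventually hrsq
    have h3 := (h1.congr_of_eventuallyEq h2.symm).unique hN'
    simpa [hR0] using h3
  have hG' : HasDerivAt (fun t => G (x t)) (fderiv ℝ G x₀ X) 0 := by
    have h1 : HasFDerivAt G (fderiv ℝ G x₀) (x 0) := by
      rw [hx0]
      exact (hsm.self_of_nhds.differentiableAt (by simp)).hasFDerivAt
    have h2 : HasDerivAt x X 0 := by
      simpa [x] using ((hasDerivAt_id (0 : ℝ)).smul_const X).const_add x₀
    exact h1.comp_hasDerivAt 0 h2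
  have hNform : ∀ u v, G x₀ (deriv N 0 u) v =
      fderiv ℝ G x₀ X u v + G x₀ (S u) v + G x₀ u (S v) := by
    intro u v
    have h1 : HasDerivAt (fun t => G x₀ (N t u) v) (G x₀ (deriv N 0 u) v) 0 := by
      have h2 := hN'.clm_apply (hasDerivAt_const (0 : ℝ) u)
      have h3 := ((hasDerivAt_const (0 : ℝ) (G x₀)).clm_apply h2).clm_apply
        (hasDerivAt_const (0 : ℝ) v)
      simpa using h3
    simp only [hN] at h1
    have h4 := (hG'.clm_apply (hB'.clm_apply (hasDerivAt_const (0 : ℝ) u))).clm_apply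
      (hB'.clm_apply (hasDerivAt_const (0 : ℝ) v))
    have h5 := h1.unique h4
    simpa [hB0, hx0] using h5
  refine ⟨A, ?_, ?_, ?_⟩
  · simp [A, hQ0, hR0, hB0]
  · have h := deformation_velocity hG hJ hGJ hW hGW hNform hRN
    refine hA'.congr_deriv (Eq.trans ?_ h)
    simp [hS, hB0, hR0, sub_eq_add_neg]
  · have hsymm := eventually_sqrt_symm hG hr1 hrsm.self_of_nhds.continuousAt hrsq hrinv
    filter_upwards [hxt.eventually hsm, hxt.eventually hs, hNt.eventually hrsm, hNt.eventually hrsq,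
      hRt.eventually hunit, hBt.eventually hunit, hNt.eventually hsymm,
      hQt.eventually det_pos_of_near_one] with t h1 h2 h3 h4 h5 h6 h7 h8
    obtain ⟨ρ, hρ⟩ := h5
    obtain ⟨β, hβ⟩ := h6
    have hRi : Ring.inverse (R t) = (ρ⁻¹ : (E →L[ℝ] E)ˣ) := by rw [← hρ, Ring.inverse_unit]
    have hBi : Ring.inverse (B t) = (β⁻¹ : (E →L[ℝ] E)ˣ) := by rw [← hβ, Ring.inverse_unit]
    have hQ : Q t = (β * ρ⁻¹ : (E →L[ℝ] E)ˣ) := by simp [Q, hRi, hβ]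
    have hQi : R t * Ring.inverse (B t) = ((β * ρ⁻¹)⁻¹ : (E →L[ℝ] E)ˣ) := by simp [hBi, hρ]
    have hA : A t = (β * ρ⁻¹ : (E →L[ℝ] E)ˣ) * J * ((β * ρ⁻¹)⁻¹ : (E →L[ℝ] E)ˣ) := by
      simp only [A, hQ, hQi]
    have hRsm : ContDiffAt ℝ ∞ R t := h3.comp t (hNsm t h1)
    have hNsymm : ∀ u v, G x₀ (N t u) v = G x₀ u (N t v) := by
      intro u v
      rw [hN, h2, ← hN, hs.self_of_nhds]
    -- `N = R * R` with `R` symmetric, so each factor `R⁻¹` of `Q` absorbs one factor `R`.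
    have hQform : ∀ u v, G (x t) (Q t u) (Q t v) = G x₀ u v := by
      intro u v
      have hRR : ∀ w, R t (Ring.inverse (R t) w) = w := fun w => by
        rw [hRi, ← hρ]
        exact DFunLike.congr_fun (Units.mul_inv ρ) w
      change G (x t) (B t (Ring.inverse (R t) u)) (B t (Ring.inverse (R t) v)) = _
      rw [← hN, ← h4]
      change G x₀ (R t (R t (Ring.inverse (R t) u))) (Ring.inverse (R t) v) = _
      rw [h7 hNsymm]
      change G x₀ (R t (Ring.inverse (R t) u)) (R t (Ring.inverse (R t) v)) = _
      rw [hRR, hRR]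
    refine ⟨?_, ?_, ?_, β * ρ⁻¹, by rwa [← hQ], hA⟩
    · have h9 : ContDiffAt ℝ ∞ (fun t => Ring.inverse (R t)) t :=
        ContDiffAt.comp (g := Ring.inverse) t (by rw [← hρ]; exact contDiffAt_ringInverse ℝ ρ) hRsm
      have h10 : ContDiffAt ℝ ∞ (fun t => Ring.inverse (B t)) t :=
        ContDiffAt.comp (g := Ring.inverse) t (by rw [← hβ]; exact contDiffAt_ringInverse ℝ β) hB.contDiffAt
      exact ((hB.contDiffAt.mul h9).mul contDiffAt_const).mul (hRsm.mul h10)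
    · rw [hA]
      calc _ = (β * ρ⁻¹ : (E →L[ℝ] E)ˣ) * (J * J) * ((β * ρ⁻¹)⁻¹ : (E →L[ℝ] E)ˣ) := by
            simp only [mul_assoc, Units.inv_mul_cancel_left]
        _ = -1 := by rw [hJ, mul_neg_one, neg_mul, Units.mul_inv]
    · intro u v
      have hQQ : ∀ w, Q t ((R t * Ring.inverse (B t)) w) = w := fun w => by
        rw [hQ, hQi]
        exact DFunLike.congr_fun (Units.mul_inv (β * ρ⁻¹)) w
      change G (x t) (Q t (J ((R t * Ring.inverse (B t)) u)))
        (Q t (J ((R t * Ring.inverse (B t)) v))) = G (x t) u v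
      rw [hQform, hGJ, ← hQform, hQQ, hQQ]

end Adjoint

/-! ### The linearized equations of the twistor space. -/

section TwistorTangent

variable {M : Type*} [TopologicalSpace M] [ChartedSpace E M] [IsManifold 𝓘(ℝ, E) ∞ M]

theorem endo_comp_of_mem {g : Metric E M} {z : EndTM E M} (hz : z ∈ twistorSpace g) :
    endo z ∘L endo z = -.id ℝ E := hz.1

theorem form_endo_of_mem {g : Metric E M} {z : EndTM E M} (hz : z ∈ twistorSpace g) (u v : E) :
    form g z.1 (endo z u) (endo z v) = form g z.1 u v := hz.2 u v

theorem mem_twistorSpace {g : Metric E M} {z : EndTM E M} (h1 : ∀ u, endo z (endo z u) = -u)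
    (h2 : ∀ u v, form g z.1 (endo z u) (endo z v) = form g z.1 u v) : z ∈ twistorSpace g :=
  ⟨ContinuousLinearMap.ext h1, h2⟩

theorem mem_twistorSpace_iff_coord (g : Metric E M) {p : M} {z : EndTM E M}
    (hz : z.1 ∈ (chartAt E p).source) :
    z ∈ twistorSpace g ↔ endCoord p z * endCoord p z = -1 ∧
      ∀ u v, localMetric g p (extChartAt 𝓘(ℝ, E) p z.1) (endCoord p z u) (endCoord p z v) =
        localMetric g p (extChartAt 𝓘(ℝ, E) p z.1) u v := by
  have hc : ∀ u, coframe p z.1 (endCoord p z u) = endo z (coframe p z.1 u) :=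
    fun u => coframe_frame hz _
  simp only [localMetric_extChartAt g hz, hc]
  constructor
  · intro h
    refine ⟨?_, fun u v => form_endo_of_mem h _ _⟩
    ext u
    have h1 : endo z (endo z (coframe p z.1 u)) = -coframe p z.1 u :=
      DFunLike.congr_fun (endo_comp_of_mem h) _
    change frame p z.1 (endo z (coframe p z.1 (endCoord p z u))) = -u
    rw [hc, h1, map_neg, frame_coframe hz]
  · rintro ⟨h1, h2⟩
    refine mem_twistorSpace (fun u => ?_) fun u v => ?_
    · have h3 : endCoord p z (endCoord p z (frame p z.1 u)) = -frame p z.1 u :=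
        DFunLike.congr_fun h1 _
      have h4 := congrArg (coframe p z.1) h3
      rwa [hc, hc, coframe_frame hz, map_neg, coframe_frame hz] at h4
    · simpa only [coframe_frame hz] using h2 (frame p z.1 u) (frame p z.1 v)

/-- The vectors `(X, W)` (in the chart at `z.1`) tangent to the twistor space at `z`. -/
def IsTangentAt (g : Metric E M) (z : EndTM E M) (X : E) (W : E →L[ℝ] E) : Prop :=
  W * endo z + endo z * W = 0 ∧ ∀ u v, metricDeriv g z.1 X (endo z u) (endo z v) +
    form g z.1 (W u) (endo z v) + form g z.1 (endo z u) (W v) = metricDeriv g z.1 X u v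

theorem endCoord_self (z : EndTM E M) : endCoord z.1 z = endo z := by
  rw [endCoord_eq, frame_self, coframe_self]
  rfl

/-- Both conditions come from differentiating `A² = -1` and `G (A u) (A v) = G u v` along the curve,
in the chart at `z.1`. -/
theorem isTangentAt_of_mem {g : Metric E M} {Z : Set (EndTM E M)} (hZ : Z ⊆ twistorSpace g)
    {z : EndTM E M} {X : E} {W : E →L[ℝ] E}
    (h : (⟨z, (X, W)⟩ : TEndTM E M) ∈ tangentVectors Z) : IsTangentAt g z X W := by
  obtain ⟨c, hc, hcZ, hcv⟩ := h
  have hz : c 0 = z := congrArg TotalSpace.proj hcv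
  obtain ⟨hX, hW⟩ := hasDerivAt_of_tangentMap hz (hc.mdifferentiableAt (by simp)) hcv
  have hsrc : ∀ᶠ t in 𝓝 (0 : ℝ), (c t).1 ∈ (chartAt E z.1).source := by
    have h1 : Continuous fun t => (c t).1 :=
      (FiberBundle.continuous_proj (E →L[ℝ] E) _).comp hc.continuous
    refine h1.continuousAt.eventually_mem ((chartAt E z.1).open_source.mem_nhds ?_)
    rw [hz]
    exact mem_chart_source E z.1
  have hA0 : endCoord z.1 (c 0) = endo z := by rw [hz, endCoord_self]
  have hx0 : extChartAt 𝓘(ℝ, E) z.1 (c 0).1 = extChartAt 𝓘(ℝ, E) z.1 z.1 := by rw [hz]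
  constructor
  · have h1 := hW.mul hW
    have h2 : ((fun t => endCoord z.1 (c t)) * fun t => endCoord z.1 (c t)) =ᶠ[𝓝 0]
        fun _ => -1 := by
      filter_upwards [hsrc] with t ht
      exact ((mem_twistorSpace_iff_coord g ht).1 (hcZ t |> @hZ _)).1
    have h3 := h1.unique ((hasDerivAt_const (0 : ℝ) (-1 : E →L[ℝ] E)).congr_of_eventuallyEq h2)
    rwa [hA0] at h3
  · intro u v
    have hG : HasFDerivAt (localMetric g z.1) (metricDeriv g z.1)
        (extChartAt 𝓘(ℝ, E) z.1 (c 0).1) := by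
      rw [metricDeriv_eq, hx0]
      exact ((contDiffAt_localMetric g z.1 (base_mem_target z.1)).differentiableAt
        (by simp)).hasFDerivAt
    have hGt := hG.comp_hasDerivAt 0 hX
    have h1 := (hGt.clm_apply (hW.clm_apply (hasDerivAt_const (0 : ℝ) u))).clm_apply
      (hW.clm_apply (hasDerivAt_const (0 : ℝ) v))
    have h2 := (hGt.clm_apply (hasDerivAt_const (0 : ℝ) u)).clm_apply
      (hasDerivAt_const (0 : ℝ) v)
    have h3 := h1.unique (h2.congr_of_eventuallyEq (by
      filter_upwards [hsrc] with t ht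
      exact ((mem_twistorSpace_iff_coord g ht).1 (hcZ t |> @hZ _)).2 u v))
    simp only [Function.comp_apply, hx0, localMetric_base, hA0, map_zero, add_zero, add_apply] at h3
    linarith

/-- Compatibility of the Levi-Civita connection with the metric; it makes the derivative of the
metric disappear from the tangency condition once `W` is replaced by its vertical part. -/
theorem metricDeriv_eq_christoffel [FiniteDimensional ℝ E] (g : Metric E M) (p : M) (X u v : E) :
    metricDeriv g p X u v =
      form g p (christoffel g p X u) v + form g p u (christoffel g p X v) := by
  rw [form_symm g p u, form_christoffel, form_christoffel, metricDeriv_symm g p X v u,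
    metricDeriv_symm g p u X v]
  rw [metricDeriv_symm g p v X u]
  ring

/-- Tangent vectors in terms of the vertical part. -/
theorem isTangentAt_iff [FiniteDimensional ℝ E] {g : Metric E M} {z : EndTM E M}
    (hz : z ∈ twistorSpace g) {X : E} {W U : E →L[ℝ] E}
    (hU : U = W + (christoffel g z.1 X ∘L endo z - endo z ∘L christoffel g z.1 X)) :
    IsTangentAt g z X W ↔ U * endo z + endo z * U = 0 ∧
      ∀ u v, form g z.1 (U u) (endo z v) + form g z.1 (endo z u) (U v) = 0 := by
  have hJJ : ∀ u, endo z (endo z u) = -u := fun u => DFunLike.congr_fun (endo_comp_of_mem hz) u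
  refine and_congr ?_ (forall₂_congr fun u v => ?_)
  · have h : U * endo z + endo z * U = W * endo z + endo z * W := by
      ext u
      simp [hU, hJJ]
      abel
    rw [h]
  · rw [metricDeriv_eq_christoffel, metricDeriv_eq_christoffel]
    simp only [hU, add_apply, sub_apply, map_add, map_sub, ContinuousLinearMap.comp_apply,
      form_endo_of_mem hz]
    constructor <;> intro h <;> linarith

theorem isTangentAt_horizontal [FiniteDimensional ℝ E] {g : Metric E M} {z : EndTM E M}
    (hz : z ∈ twistorSpace g) (X : E) :
    IsTangentAt g z X (-(christoffel g z.1 X ∘L endo z - endo z ∘L christoffel g z.1 X)) := by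
  rw [isTangentAt_iff hz (U := 0) (by simp)]
  simp

/-- The vertical part becomes `ε • z ∘ U`, and the conditions on `U` (anticommuting with `z`, skew)
are stable under composition with `z`. -/
theorem isTangentAt_almostComplex [FiniteDimensional ℝ E] {g : Metric E M} {z : EndTM E M}
    (hz : z ∈ twistorSpace g) {X : E} {W : E →L[ℝ] E} (h : IsTangentAt g z X W) (ε : ℝ) :
    IsTangentAt g z (endo z X) (ε • (endo z ∘L
        (W + (christoffel g z.1 X ∘L endo z - endo z ∘L christoffel g z.1 X))) -
      (christoffel g z.1 (endo z X) ∘L endo z - endo z ∘L christoffel g z.1 (endo z X))) := by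
  set U := W + (christoffel g z.1 X ∘L endo z - endo z ∘L christoffel g z.1 X) with hU
  rw [isTangentAt_iff hz hU] at h
  rw [isTangentAt_iff hz (U := ε • (endo z ∘L U)) (by simp)]
  have hJJ : ∀ u, endo z (endo z u) = -u := fun u => DFunLike.congr_fun (endo_comp_of_mem hz) u
  have hUJ : ∀ u, U (endo z u) = -endo z (U u) := fun u =>
    eq_neg_of_add_eq_zero_left (DFunLike.congr_fun h.1 u)
  constructor
  · ext u
    simp [hUJ, hJJ]
  · intro u v
    have h1 := h.2 u (endo z v)
    rw [hJJ, hUJ, map_neg, map_neg, form_endo_of_mem hz] at h1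
    simp only [smul_apply, ContinuousLinearMap.comp_apply, map_smul, form_endo_of_mem hz,
      smul_eq_mul]
    linear_combination (-ε) * h1

end TwistorTangent

/-! ### Curves in the full and positive twistor spaces. -/

section Deformation

variable {M : Type*} [TopologicalSpace M] [ChartedSpace E M] [IsManifold 𝓘(ℝ, E) ∞ M]
  [FiniteDimensional ℝ E]

/-- A smooth curve in the twistor space with a prescribed tangent vector. -/
theorem exists_curve {g : Metric E M} {z : EndTM E M} (hz : z ∈ twistorSpace g) {X : E}
    {W : E →L[ℝ] E} (h : IsTangentAt g z X W) {P : M → Prop} (hP : ∀ᶠ q in 𝓝 z.1, P q) :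
    ∃ c : ℝ → EndTM E M, ContMDiff 𝓘(ℝ, ℝ) (endModel E) ∞ c ∧
      tangentMap 𝓘(ℝ, ℝ) (endModel E) c ⟨0, (1 : ℝ)⟩ = ⟨z, (X, W)⟩ ∧
      ∀ t, c t ∈ twistorSpace g ∧ (c t).1 ∈ (chartAt E z.1).source ∧ P (c t).1 ∧
        ∃ Q : (E →L[ℝ] E)ˣ, 0 < LinearMap.det (Q : E →L[ℝ] E).toLinearMap ∧
          endCoord z.1 (c t) = Q * endo z * (Q⁻¹ : (E →L[ℝ] E)ˣ) := by
  set p := z.1 with hp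
  set x₀ := extChartAt 𝓘(ℝ, E) p p with hx₀
  have hG0 : localMetric g p x₀ = form g p := localMetric_base g p
  have htgt := target_mem_nhds (E := E) p (base_mem_target p)
  -- The base point moves along the straight line `x₀ + t X` of the chart; this is controlled only
  -- for small `t`.
  obtain ⟨A, hA0, hA', hA⟩ := exists_deformation (G := localMetric g p) (x₀ := x₀) (X := X)
    (J := endo z) (W := W)
    (Filter.mem_of_superset htgt fun x hx => contDiffAt_localMetric g p hx)
    (Filter.mem_of_superset htgt fun x hx => localMetric_symm g hx)
    (by rw [hG0]; exact form_invertible g p) (endo_comp_of_mem hz)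
    (by rw [hG0]; exact form_endo_of_mem hz) h.1
    (by rw [hG0, ← metricDeriv_eq]; exact h.2)
  have hxt : Filter.Tendsto (fun t : ℝ => x₀ + t • X) (𝓝 0) (𝓝 x₀) := by
    have : Continuous fun t : ℝ => x₀ + t • X := by fun_prop
    simpa using this.tendsto 0
  have hPx : ∀ᶠ x in 𝓝 x₀, P ((extChartAt 𝓘(ℝ, E) p).symm x) := by
    have h1 : ContinuousAt (extChartAt 𝓘(ℝ, E) p).symm x₀ := continuousAt_extChartAt_symm p
    refine h1.eventually ?_
    rwa [hx₀, extChartAt_to_inv]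
  obtain ⟨δ, hδ, hball⟩ := Metric.eventually_nhds_iff.1
    ((hA.and (hxt.eventually htgt)).and (hxt.eventually hPx))
  -- reparametrization
  let τ : ℝ → ℝ := fun t => δ / 2 * Real.sin (t / (δ / 2))
  have hτ : ContDiff ℝ ∞ τ := contDiff_const.mul (Real.contDiff_sin.comp (contDiff_id.div_const _))
  have hτ0 : τ 0 = 0 := by simp [τ]
  have hτ' : HasDerivAt τ 1 0 := by
    have h1 := (((hasDerivAt_id (0 : ℝ)).div_const (δ / 2)).sin).const_mul (δ / 2)
    refine h1.congr_deriv ?_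
    simp
    field_simp
  -- `tangentVectors` asks for curves defined on all of `ℝ` inside `Z`. The sine keeps the parameter
  -- within `δ / 2` while its derivative at `0` is `1`.
  have hτδ : ∀ t, dist (τ t) 0 < δ := by
    intro t
    have h1 := Real.abs_sin_le_one (t / (δ / 2))
    rw [Real.dist_0_eq_abs, abs_mul, abs_of_pos (half_pos hδ)]
    nlinarith
  let x : ℝ → E := fun t => x₀ + τ t • X
  have hx : ContDiff ℝ ∞ x := contDiff_const.add (hτ.smul contDiff_const)
  have hxtgt : ∀ t, x t ∈ (extChartAt 𝓘(ℝ, E) p).target := fun t => (hball (hτδ t)).1.2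
  have hAτ : ContDiff ℝ ∞ (A ∘ τ) := contDiff_iff_contDiffAt.2 fun t =>
    (hball (hτδ t)).1.1.1.comp t hτ.contDiffAt
  have hcoord : ∀ t, endCoord p (ofCoord p (x t) ((A ∘ τ) t)) = A (τ t) := fun t =>
    endCoord_ofCoord (hxtgt t) _
  have hchart : ∀ t, extChartAt 𝓘(ℝ, E) p (ofCoord p (x t) ((A ∘ τ) t)).1 = x t := fun t =>
    (extChartAt 𝓘(ℝ, E) p).right_inv (hxtgt t)
  have hc := contMDiff_ofCoord p hxtgt hx hAτ
  have hc0 : ofCoord p (x 0) ((A ∘ τ) 0) = z := by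
    have : x 0 = x₀ := by simp [x, hτ0]
    rw [this, Function.comp, hτ0, hA0]
    exact ofCoord_base z
  refine ⟨fun t => ofCoord p (x t) ((A ∘ τ) t), hc, ?_, fun t => ?_⟩
  · have h1 := velocity_eq (X := X) (W := W) hc0 (hc.mdifferentiableAt (by simp))
      (by
        simp only [← hp, hchart]
        simpa [x] using (hτ'.smul_const X).const_add x₀)
      (by
        simp only [← hp, hcoord]
        exact (hA'.scomp_of_eq 0 hτ' hτ0.symm).congr_deriv (one_smul ℝ W))
    have h2 : tangentMap 𝓘(ℝ, ℝ) (endModel E) (fun t => ofCoord p (x t) ((A ∘ τ) t))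
        ⟨0, (1 : ℝ)⟩ = ⟨ofCoord p (x 0) ((A ∘ τ) 0),
          velocity (fun t => ofCoord p (x t) ((A ∘ τ) t))⟩ := rfl
    rw [h2, h1, hc0]
  · obtain ⟨⟨⟨-, hsq, hform, hQ⟩, htt⟩, hPt⟩ := hball (hτδ t)
    refine ⟨?_, symm_mem_source (hxtgt t), hPt, ?_⟩
    · rw [mem_twistorSpace_iff_coord g (symm_mem_source (hxtgt t)), hcoord, hchart]
      exact ⟨hsq, hform⟩
    · rwa [hcoord]

theorem Induces.map {m : ℕ} {V V' : Type*} [AddCommGroup V] [Module ℝ V] [AddCommGroup V']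
    [Module ℝ V'] {J : V → V} {J' : V' → V'} {o : Orientation ℝ V (Fin m × Fin 2)}
    (h : Induces J o) (e : V ≃ₗ[ℝ] V') (he : ∀ v, J' (e v) = e (J v)) :
    Induces J' (Orientation.map (Fin m × Fin 2) e o) := by
  obtain ⟨b, hb, rfl⟩ := h
  refine ⟨b.map e, fun k => ?_, b.orientation_map e⟩
  rw [Module.Basis.map_apply, Module.Basis.map_apply, hb, he]

/-- The coordinate frame of the chart at `p`, as a linear equivalence. -/
def frameEquiv {p q : M} (hq : q ∈ (chartAt E p).source) :
    TangentSpace 𝓘(ℝ, E) q ≃ₗ[ℝ] E :=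
  (trivializationAt E (TangentSpace 𝓘(ℝ, E)) p).linearEquivAt ℝ q hq

theorem frameEquiv_apply {p q : M} (hq : q ∈ (chartAt E p).source) (u : E) :
    frameEquiv hq u = frame p q u :=
  (congrArg (fun f => f u) ((trivializationAt E (TangentSpace 𝓘(ℝ, E)) p).coe_linearMapAt_of_mem
    (R := ℝ) hq)).symm

theorem frameEquiv_endo {p : M} {z : EndTM E M} (hq : z.1 ∈ (chartAt E p).source) (u : E) :
    endCoord p z (frameEquiv hq u) = frameEquiv hq (endo z u) := by
  rw [frameEquiv_apply, frameEquiv_apply]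
  change frame p z.1 (endo z (coframe p z.1 (frame p z.1 u))) = _
  rw [coframe_frame hq]

/-- In the coordinate frame at `z.1` the two orientations agree and the endomorphism at `w` is a
conjugate of that at `z` by a map of positive determinant, which preserves the orientation. So
curves from `exists_curve` that start in the positive twistor space stay there. -/
theorem induces_of_curve {m : ℕ} (hE : Module.finrank ℝ E = 2 * m) (o : ManifoldOrientation E M m)
    {z w : EndTM E M} (hz : Induces z.2 (o.at' z.1)) (hw : w.1 ∈ (chartAt E z.1).source)
    (ho : ∀ hq : w.1 ∈ (chartAt E z.1).source,
      Orientation.map (Fin m × Fin 2) (frameEquiv hq) (o.at' w.1) =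
        Orientation.map (Fin m × Fin 2) (frameEquiv (mem_chart_source E z.1)) (o.at' z.1))
    {Q : (E →L[ℝ] E)ˣ} (hQ : 0 < LinearMap.det (Q : E →L[ℝ] E).toLinearMap)
    (hQw : endCoord z.1 w = Q * endo z * (Q⁻¹ : (E →L[ℝ] E)ˣ)) :
    Induces w.2 (o.at' w.1) := by
  have h1 : Induces (endo z)
      (Orientation.map (Fin m × Fin 2) (frameEquiv (mem_chart_source E z.1)) (o.at' z.1)) := by
    refine hz.map _ fun v => ?_
    rw [← endCoord_self]
    exact frameEquiv_endo (mem_chart_source E z.1) v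
  let e : E ≃ₗ[ℝ] E := (ContinuousLinearEquiv.ofUnit Q).toLinearEquiv
  have h2 : Induces (endCoord z.1 w) _ := h1.map e fun v => by
    rw [hQw]
    exact congrArg (fun x => (Q : E →L[ℝ] E) (endo z x)) (DFunLike.congr_fun (Units.inv_mul Q) v)
  rw [(Orientation.map_eq_iff_det_pos _ e (by simp [hE, mul_comm])).2 hQ, ← ho hw] at h2
  have h3 := h2.map (J' := w.2) (frameEquiv hw).symm fun v => by
    obtain ⟨u, rfl⟩ := (frameEquiv hw).surjective v
    rw [LinearEquiv.symm_apply_apply]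
    exact ((LinearEquiv.symm_apply_eq _).2 (frameEquiv_endo hw u)).symm
  rwa [← Orientation.map_symm, Equiv.symm_apply_apply] at h3

/-- The properties shared by the full and the positive twistor spaces. -/
structure IsTwistorFamily (g : Metric E M) (Z : Set (EndTM E M)) : Prop where
  subset : Z ⊆ twistorSpace g
  tangent : ∀ z ∈ Z, ∀ (X : E) (W : E →L[ℝ] E), IsTangentAt g z X W →
    (⟨z, (X, W)⟩ : TEndTM E M) ∈ tangentVectors Z
  rich : ∀ (p : M) (u v : E), form g p u u = 1 → form g p v v = 1 → form g p u v = 0 →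
    ∃ z ∈ Z, z.1 = p ∧ (endo z u = v ∨ endo z u = -v)

theorem isTwistorFamily_twistorSpace {m : ℕ} (hE : Module.finrank ℝ E = 2 * m) (g : Metric E M) :
    IsTwistorFamily g (twistorSpace g) where
  subset := subset_rfl
  tangent z hz X W h := by
    obtain ⟨c, h1, h2, h3⟩ := exists_curve hz h (P := fun _ => True) (by simp)
    exact ⟨c, h1, fun t => (h3 t).1, h2⟩
  rich p u v hu hv huv := by
    obtain ⟨b, hb, k, hk, hk'⟩ := exists_basis_extending hE (form_symm g p)
      (fun _ => form_pos g p) hu hv huv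
    obtain ⟨J, hJ, hJJ, hJB⟩ := exists_complexStructure_of_basis b hb
    refine ⟨⟨p, J⟩, ⟨hJJ, hJB⟩, rfl, .inl ?_⟩
    rw [← hk, ← hk', hJ]
    rfl

theorem isTwistorFamily_positiveTwistorSpace {m : ℕ} (hE : Module.finrank ℝ E = 2 * m)
    (g : Metric E M) (o : ManifoldOrientation E M m) :
    IsTwistorFamily g (positiveTwistorSpace g o) where
  subset := fun _ hz => hz.1
  tangent z hz X W h := by
    obtain ⟨c, h1, h2, h3⟩ := exists_curve hz.1 h (o.locally_constant z.1)
    refine ⟨c, h1, fun t => ⟨(h3 t).1, ?_⟩, h2⟩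
    obtain ⟨-, hs, ho, Q, hQ, hQc⟩ := h3 t
    exact induces_of_curve hE o hz.2 hs ho hQ hQc
  rich p u v hu hv huv := by
    obtain ⟨b, hb, ⟨k, hk, hk'⟩, ho⟩ := exists_oriented_basis_extending hE (form_symm g p)
      (fun _ => form_pos g p) hu hv huv (o.at' p)
    obtain ⟨J, hJ, hJJ, hJB⟩ := exists_complexStructure_of_basis b hb
    refine ⟨⟨p, J⟩, ⟨⟨hJJ, hJB⟩, b, hJ, ho⟩, rfl, ?_⟩
    rw [hJ, hk] at hk'
    exact hk'

end Deformation

/-! ### The holomorphy equation for bundle maps. -/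

section Holomorphic

variable {M : Type*} [TopologicalSpace M] [ChartedSpace E M] [IsManifold 𝓘(ℝ, E) ∞ M]
  {M' : Type*} [TopologicalSpace M'] [ChartedSpace E M'] [IsManifold 𝓘(ℝ, E) ∞ M']
  {Z : Set (EndTM E M)} {Z' : Set (EndTM E M')} {f : Z → Z'}
  {φ : M ≃ₘ^∞⟮𝓘(ℝ, E), 𝓘(ℝ, E)⟯ M'} {g : Metric E M} {g' : Metric E M'}

/-- The differential of an extension of a bundle map, along a curve. -/
theorem exists_tangentMap_curve (hbase : ∀ z : Z, (f z).1.1 = φ z.1.1) {z : Z}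
    {F : EndTM E M → EndTM E M'} (hF : IsSmoothExtensionAt f z F) {c : ℝ → EndTM E M}
    (hc : ContMDiff 𝓘(ℝ, ℝ) (endModel E) ∞ c) (hcZ : ∀ t, c t ∈ Z) {X : E} {W : E →L[ℝ] E}
    (hcv : tangentMap 𝓘(ℝ, ℝ) (endModel E) c ⟨0, (1 : ℝ)⟩ = ⟨z.1, (X, W)⟩) :
    ∃ V : E →L[ℝ] E, tangentMap (endModel E) (endModel E) F ⟨z.1, (X, W)⟩ =
        ⟨f z, (differential φ z.1.1 X, V)⟩ ∧
      HasDerivAt (fun t => endCoord (φ z.1.1) (f ⟨c t, hcZ t⟩).1) V 0 := by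
  obtain ⟨z, hzZ⟩ := z
  have hz : c 0 = z := congrArg TotalSpace.proj hcv
  obtain ⟨hFs, hFf⟩ := hF
  have hFz : F z = f ⟨z, hzZ⟩ := hFf.self_of_nhds
  have hcd : MDifferentiableAt 𝓘(ℝ, ℝ) (endModel E) c 0 := hc.mdifferentiableAt (by simp)
  have hFd : MDifferentiableAt (endModel E) (endModel E) F (c 0) := by
    rw [hz]
    exact hFs.mdifferentiableAt (by simp)
  have hev : ∀ᶠ t in 𝓝 (0 : ℝ), F (c t) = f ⟨c t, hcZ t⟩ := by
    have h1 : Continuous fun t => (⟨c t, hcZ t⟩ : Z) := hc.continuous.subtype_mk _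
    have h2 : (⟨c 0, hcZ 0⟩ : Z) = ⟨z, hzZ⟩ := Subtype.ext hz
    have h3 := h1.tendsto 0
    rw [h2] at h3
    exact h3.eventually hFf
  have hsrc : ∀ᶠ t in 𝓝 (0 : ℝ), (c t).1 ∈ (chartAt E z.1).source := by
    have h1 : Continuous fun t => (c t).1 :=
      (FiberBundle.continuous_proj (E →L[ℝ] E) _).comp hc.continuous
    refine h1.continuousAt.eventually_mem ((chartAt E z.1).open_source.mem_nhds ?_)
    rw [hz]
    exact mem_chart_source E z.1
  -- The extension agrees with `f` only on `Z`, so its differential is read off along a curve that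
  -- stays in `Z`.
  have hv : tangentMap (endModel E) (endModel E) F ⟨z, (X, W)⟩ =
      tangentMap 𝓘(ℝ, ℝ) (endModel E) (F ∘ c) ⟨0, (1 : ℝ)⟩ := by
    rw [tangentMap_comp_at (I' := endModel E) _ hFd hcd, hcv]
  have hv2 : tangentMap 𝓘(ℝ, ℝ) (endModel E) (F ∘ c) ⟨0, (1 : ℝ)⟩ =
      ⟨F (c 0), ((velocity (F ∘ c)).1, (velocity (F ∘ c)).2)⟩ := rfl
  have hz' : (F ∘ c) 0 = f ⟨z, hzZ⟩ := by rw [Function.comp, hz, hFz]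
  rw [hz, hFz] at hv2
  obtain ⟨hX', hV⟩ := hasDerivAt_of_tangentMap hz' (hFd.comp 0 hcd) hv2
  rw [hbase] at hX' hV
  have hX := (hasDerivAt_of_tangentMap hz hcd hcv).1
  have hψ : HasFDerivAt (localMap φ z.1) (differential φ z.1)
      (extChartAt 𝓘(ℝ, E) z.1 (c 0).1) := by
    rw [hz, ← fderiv_localMap_base φ.contMDiff]
    exact ((contDiffAt_localMap φ.contMDiff (mem_chart_source E z.1)
      (mem_chart_source E (φ z.1))).differentiableAt (by simp)).hasFDerivAt
  have h4 := hψ.comp_hasDerivAt 0 hX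
  have h5 : (velocity (F ∘ c)).1 = differential φ z.1 X := by
    refine hX'.unique (h4.congr_of_eventuallyEq ?_)
    filter_upwards [hev, hsrc] with t ht hts
    rw [Function.comp, Function.comp, ht, hbase, localMap, symm_extChartAt hts]
  refine ⟨(velocity (F ∘ c)).2, ?_, hV.congr_of_eventuallyEq ?_⟩
  · rw [hv, hv2, h5]
  · filter_upwards [hev] with t ht
    rw [Function.comp, ht]

theorem exists_tangentMap (hbase : ∀ z : Z, (f z).1.1 = φ z.1.1) {z : Z}
    {F : EndTM E M → EndTM E M'} (hF : IsSmoothExtensionAt f z F) {X : E} {W : E →L[ℝ] E}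
    (hv : (⟨z.1, (X, W)⟩ : TEndTM E M) ∈ tangentVectors Z) :
    ∃ V : E →L[ℝ] E, tangentMap (endModel E) (endModel E) F ⟨z.1, (X, W)⟩ =
        ⟨f z, (differential φ z.1.1 X, V)⟩ := by
  obtain ⟨c, hc, hcZ, hcv⟩ := hv
  obtain ⟨V, hV, -⟩ := exists_tangentMap_curve hbase hF hc hcZ hcv
  exact ⟨V, hV⟩

/-- The second derivative of a map in charts. -/
def hessian (φ : M → M') (p : M) : E →L[ℝ] E →L[ℝ] E :=
  fderiv ℝ (fderiv ℝ (localMap φ p)) (extChartAt 𝓘(ℝ, E) p p)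

theorem hessian_symm {φ : M → M'} (hφ : ContMDiff 𝓘(ℝ, E) 𝓘(ℝ, E) ∞ φ) (p : M) (X Y : E) :
    hessian φ p X Y = hessian φ p Y X := by
  have h : ContDiffAt ℝ ∞ (localMap φ p) (extChartAt 𝓘(ℝ, E) p p) :=
    contDiffAt_localMap hφ (mem_chart_source E p) (mem_chart_source E (φ p))
  exact (h.isSymmSndFDerivAt (by
    rw [minSmoothness_of_isRCLikeNormedField]
    exact WithTop.coe_le_coe.2 (le_top (a := (2 : ℕ∞))))).eq X Y

theorem hasFDerivAt_fderiv_localMap {φ : M → M'} (hφ : ContMDiff 𝓘(ℝ, E) 𝓘(ℝ, E) ∞ φ) (p : M) :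
    HasFDerivAt (fderiv ℝ (localMap φ p)) (hessian φ p) (extChartAt 𝓘(ℝ, E) p p) :=
  (((contDiffAt_localMap hφ (mem_chart_source E p) (mem_chart_source E (φ p))).fderiv_right
    (m := ∞) le_rfl).differentiableAt (by simp)).hasFDerivAt

/-- In charts conjugation reads `A' (Dψ u) = Dψ (A u)`, with `ψ` the local form of `φ`. Its
derivative along the curve gives the formula for `V`. -/
theorem exists_tangentMap_conjugate (hconj : ∀ z : Z, (f z).1 = conjugate φ z.1) {z : Z}
    {F : EndTM E M → EndTM E M'} (hF : IsSmoothExtensionAt f z F) {X : E} {W : E →L[ℝ] E}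
    (hv : (⟨z.1, (X, W)⟩ : TEndTM E M) ∈ tangentVectors Z) :
    ∃ V : E →L[ℝ] E, tangentMap (endModel E) (endModel E) F ⟨z.1, (X, W)⟩ =
        ⟨f z, (differential φ z.1.1 X, V)⟩ ∧
      ∀ u, V (differential φ z.1.1 u) = differential φ z.1.1 (W u) +
        hessian φ z.1.1 X (endo z.1 u) - endo (conjugate φ z.1) (hessian φ z.1.1 X u) := by
  obtain ⟨c, hc, hcZ, hcv⟩ := hv
  obtain ⟨V, hV, hVd⟩ := exists_tangentMap_curve (fun z => by rw [hconj]; rfl) hF hc hcZ hcv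
  refine ⟨V, hV, fun u => ?_⟩
  have hz : c 0 = z.1 := congrArg TotalSpace.proj hcv
  obtain ⟨hX, hW⟩ := hasDerivAt_of_tangentMap hz (hc.mdifferentiableAt (by simp)) hcv
  have hDψ : HasFDerivAt (fderiv ℝ (localMap φ z.1.1)) (hessian φ z.1.1)
      (extChartAt 𝓘(ℝ, E) z.1.1 (c 0).1) := by
    rw [hz]
    exact hasFDerivAt_fderiv_localMap φ.contMDiff z.1.1
  have hD := hDψ.comp_hasDerivAt 0 hX
  have h1 := hVd.clm_apply (hD.clm_apply (hasDerivAt_const (0 : ℝ) u))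
  have h2 := hD.clm_apply (hW.clm_apply (hasDerivAt_const (0 : ℝ) u))
  have hsrc : ∀ᶠ t in 𝓝 (0 : ℝ), (c t).1 ∈ (chartAt E z.1.1).source ∧
      φ (c t).1 ∈ (chartAt E (φ z.1.1)).source := by
    have h1 : Continuous fun t => (c t).1 :=
      (FiberBundle.continuous_proj (E →L[ℝ] E) _).comp hc.continuous
    have h2 := h1.tendsto 0
    rw [hz] at h2
    exact h2.eventually (eventually_mem_source (E := E) φ.continuous z.1.1)
  have h3 := h1.unique (h2.congr_of_eventuallyEq (by
    filter_upwards [hsrc] with t ht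
    rw [hconj]
    exact endCoord_conjugate φ (c t) ht.1 ht.2 u))
  have h4 : endCoord (φ z.1.1) (f ⟨c 0, hcZ 0⟩).1 = endo (conjugate φ z.1) := by
    rw [hconj]
    change endCoord _ (conjugate φ (c 0)) = _
    rw [hz, ← endCoord_self]
    rfl
  have h5 : extChartAt 𝓘(ℝ, E) z.1.1 (c 0).1 = extChartAt 𝓘(ℝ, E) z.1.1 z.1.1 := by rw [hz]
  have h6 : endCoord z.1.1 (c 0) = endo z.1 := by rw [hz, endCoord_self]
  simp only [Function.comp_apply, h4, h5, h6, fderiv_localMap_base φ.contMDiff, map_zero,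
    add_zero] at h3
  rw [eq_sub_iff_add_eq, h3, add_comm]

variable [FiniteDimensional ℝ E]

/-- Needed because the differential of an extension of `f` is determined by `f` only on vectors
tangent to `Z`. -/
theorem mem_tangentVectors_almostComplex (hZ : IsTwistorFamily g Z) {z : Z} {X : E}
    {W : E →L[ℝ] E} (hv : IsTangentAt g z.1 X W) (ε : ℝ) :
    almostComplex g ε ⟨z.1, (X, W)⟩ ∈ tangentVectors Z := by
  rw [almostComplex_apply]
  exact hZ.tangent _ z.2 _ _ (isTangentAt_almostComplex (hZ.subset z.2) hv ε)

/-- Holomorphic bundle maps are given by conjugation. -/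
theorem eq_conjugate_of_isHolomorphic (hZ : IsTwistorFamily g Z)
    (hbase : ∀ z : Z, (f z).1.1 = φ z.1.1) {ε : ℝ}
    (hf : IsHolomorphic f (almostComplex g ε) (almostComplex g' ε)) (z : Z) :
    (f z).1 = conjugate φ z.1 := by
  refine eq_conjugate (hbase z) fun X => ?_
  obtain ⟨F, hF⟩ := hf.1 z
  have ht := isTangentAt_horizontal (hZ.subset z.2) X
  set W := -(christoffel g z.1.1 X ∘L endo z.1 - endo z.1 ∘L christoffel g z.1.1 X)
  have hv := hZ.tangent _ z.2 _ _ ht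
  have h1 := hf.2 z F hF _ hv rfl
  have h2 := mem_tangentVectors_almostComplex hZ ht ε
  obtain ⟨V, hV⟩ := exists_tangentMap hbase hF hv
  rw [almostComplex_apply] at h1 h2
  obtain ⟨V₂, hV₂⟩ := exists_tangentMap hbase hF h2
  rw [hV, hV₂, almostComplex_apply] at h1
  have h3 := eq_of_heq (TotalSpace.mk.inj h1).2
  -- The component along the base does not involve `ε`.
  exact (congrArg Prod.fst h3).symm

/-- Half of the logarithmic gradient of the conformal factor. -/
def gradient (g : Metric E M) (h : M → ℝ) (p : M) : E :=
  (form g p).inverse (fderiv ℝ (h ∘ (extChartAt 𝓘(ℝ, E) p).symm) (extChartAt 𝓘(ℝ, E) p p))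

theorem form_gradient (g : Metric E M) (h : M → ℝ) (p : M) :
    form g p (gradient g h p) =
      fderiv ℝ (h ∘ (extChartAt 𝓘(ℝ, E) p).symm) (extChartAt 𝓘(ℝ, E) p p) :=
  (form_invertible g p).self_apply_inverse _

/-- The base components of the two sides agree because `f` is conjugation, so only the second
components matter. The resulting condition is free of `W`, so testing it on horizontal vectors is
enough. -/
theorem isHolomorphic_iff_conformalTerm (hZ : IsTwistorFamily g Z)
    (hconj : ∀ z : Z, (f z).1 = conjugate φ z.1) (hsm : IsSmooth f) {h : M → ℝ}
    (hh : ContMDiff 𝓘(ℝ, E) 𝓘(ℝ, ℝ) ∞ h)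
    (hconf : ∀ q u v, form g' (φ q) (differential φ q u) (differential φ q v) =
      Real.exp (2 * h q) * form g q u v) (ε : ℝ) :
    IsHolomorphic f (almostComplex g ε) (almostComplex g' ε) ↔
      ∀ (z : Z) (X Y : E),
        conformalTerm (form g z.1.1) (gradient g h z.1.1) (endo z.1) (endo z.1 X) Y =
          ε • endo z.1 (conformalTerm (form g z.1.1) (gradient g h z.1.1) (endo z.1) X Y) := by
  have key : ∀ (z : Z) (F : EndTM E M → EndTM E M'), IsSmoothExtensionAt f z F →
      ∀ (X : E) (W : E →L[ℝ] E), IsTangentAt g z.1 X W →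
        (tangentMap (endModel E) (endModel E) F (almostComplex g ε ⟨z.1, (X, W)⟩) =
          almostComplex g' ε (tangentMap (endModel E) (endModel E) F ⟨z.1, (X, W)⟩) ↔
        ∀ Y, conformalTerm (form g z.1.1) (gradient g h z.1.1) (endo z.1) (endo z.1 X) Y =
          ε • endo z.1 (conformalTerm (form g z.1.1) (gradient g h z.1.1) (endo z.1) X Y)) := by
    intro z F hF X W ht
    obtain ⟨V, hV, hVu⟩ := exists_tangentMap_conjugate hconj hF (hZ.tangent _ z.2 _ _ ht)
    have h2 := mem_tangentVectors_almostComplex hZ ht ε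
    rw [almostComplex_apply] at h2
    obtain ⟨V₂, hV₂, hV₂u⟩ := exists_tangentMap_conjugate hconj hF h2
    have hchr := christoffel_conformal (G := form g z.1.1) (G' := form g' (φ z.1.1))
      (form_symm g' _) (fun u => form_pos g' _) (differential_bijective φ z.1.1).2
      (form_christoffel g z.1.1) (form_christoffel g' (φ z.1.1)) (hessian_symm φ.contMDiff z.1.1)
      (hconf z.1.1) (a := gradient g h z.1.1) (by
        intro X u v
        rw [form_gradient]
        exact metricDeriv_conformal φ.contMDiff hh hconf z.1.1 X u v)
    rw [← holomorphic_iff_conformalTerm (differential_bijective φ z.1.1)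
      (endo_conjugate φ z.1) hchr ε hVu hV₂u, almostComplex_apply, hV, hV₂, hconj,
      almostComplex_apply]
    constructor
    · intro h1
      have h3 := eq_of_heq (TotalSpace.mk.inj h1).2
      exact congrArg Prod.snd h3
    · intro h1
      rw [h1, endo_conjugate]
      rfl
  constructor
  · intro hf z X
    obtain ⟨F, hF⟩ := hf.1 z
    have ht := isTangentAt_horizontal (hZ.subset z.2) X
    exact (key z F hF X _ ht).1 (hf.2 z F hF _ (hZ.tangent _ z.2 _ _ ht) rfl)
  · intro hc
    refine ⟨hsm, ?_⟩
    rintro z F hF ⟨w, X, W⟩ hv (rfl : w = z.1)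
    exact (key z F hF X W (isTangentAt_of_mem hZ.subset hv)).2 (hc z X)

end Holomorphic

/-! ### Conformality, homotheties and the two equivalences. -/

section Conformal

variable {M : Type*} [TopologicalSpace M] [ChartedSpace E M] [IsManifold 𝓘(ℝ, E) ∞ M]
  {M' : Type*} [TopologicalSpace M'] [ChartedSpace E M'] [IsManifold 𝓘(ℝ, E) ∞ M']
  {Z : Set (EndTM E M)} {Z' : Set (EndTM E M')} {f : Z → Z'}
  {φ : M ≃ₘ^∞⟮𝓘(ℝ, E), 𝓘(ℝ, E)⟯ M'} {g : Metric E M} {g' : Metric E M'}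
  [FiniteDimensional ℝ E]

theorem pullback_proportional (hZ : IsTwistorFamily g Z) (hZ' : Z' ⊆ twistorSpace g')
    (hconj : ∀ z : Z, (f z).1 = conjugate φ z.1) (p : M) (e u v : E) :
    form g' (φ p) (differential φ p u) (differential φ p v) * form g p e e =
      form g' (φ p) (differential φ p e) (differential φ p e) * form g p u v := by
  refine proportional_of_invariant (B := form g p)
    (B' := (form g' (φ p)).bilinearComp (differential φ p) (differential φ p)) (form_symm g p)
    (fun _ => form_pos g p) (fun u v => form_symm g' _ _ _) (fun u v hu hv huv => ?_) e u v
  obtain ⟨z, hz, rfl, hzu⟩ := hZ.rich p u v hu hv huv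
  refine ⟨endo z, hzu, endo_comp_of_mem (hZ.subset hz), fun x y => ?_⟩
  have h1 := hZ' (f ⟨z, hz⟩).2
  rw [hconj] at h1
  have h2 := form_endo_of_mem h1 (differential φ z.1 x) (differential φ z.1 y)
  rw [endo_conjugate, endo_conjugate] at h2
  exact h2

theorem differential_ne_zero {p : M} {u : E} (hu : u ≠ 0) : differential φ p u ≠ 0 := fun h =>
  hu ((differential_bijective φ p).1 (h.trans (map_zero _).symm))

theorem exists_conformal_factor (hZ : IsTwistorFamily g Z) (hZ' : Z' ⊆ twistorSpace g')
    (hconj : ∀ z : Z, (f z).1 = conjugate φ z.1) :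
    ∃ h : M → ℝ, ContMDiff 𝓘(ℝ, E) 𝓘(ℝ, ℝ) ∞ h ∧ ∀ q u v,
      form g' (φ q) (differential φ q u) (differential φ q v) =
        Real.exp (2 * h q) * form g q u v := by
  rcases subsingleton_or_nontrivial E with hE | hE
  · refine ⟨fun _ => 0, contMDiff_const, fun q u v => ?_⟩
    rw [Subsingleton.elim u 0]
    simp
  obtain ⟨e, he⟩ := exists_ne (0 : E)
  have hpos : ∀ q {u : E}, u ≠ 0 →
      0 < form g' (φ q) (differential φ q u) (differential φ q u) / form g q u u := fun q u hu =>
    div_pos (form_pos g' _ (differential_ne_zero hu)) (form_pos g q hu)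
  refine ⟨fun q => (1 / 2) * Real.log (form g' (φ q) (differential φ q e) (differential φ q e) /
    form g q e e), fun p => ?_, fun q u v => ?_⟩
  -- The fixed `e`, viewed in every tangent space through its own preferred chart, need not be a
  -- smooth vector field. By proportionality the ratio is the same for the coordinate field of the
  -- chart at `p`, for which smoothness is visible.
  · let F : E → ℝ := fun x => (1 / 2) * Real.log
      (localMetric g' (φ p) (localMap φ p x) (fderiv ℝ (localMap φ p) x e)
        (fderiv ℝ (localMap φ p) x e) / localMetric g p x e e)
    have hcof : ∀ {q}, q ∈ (chartAt E p).source → coframe p q e ≠ 0 := fun hq h => by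
      have := frame_coframe hq e
      rw [h, map_zero] at this
      exact he this.symm
    have heq : (fun q => (1 / 2) * Real.log
        (form g' (φ q) (differential φ q e) (differential φ q e) / form g q e e)) =ᶠ[𝓝 p]
        F ∘ extChartAt 𝓘(ℝ, E) p := by
      filter_upwards [eventually_mem_source (E := E) φ.continuous p] with q hq
      simp only [F, Function.comp_apply]
      rw [localMetric_localMap φ.contMDiff hq.1 hq.2, localMetric_extChartAt g hq.1]
      congr 2
      rw [div_eq_div_iff (form_pos g q he).ne' (form_pos g q (hcof hq.1)).ne']
      exact (pullback_proportional hZ hZ' hconj q (coframe p q e) e e)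
    refine ContMDiffAt.congr_of_eventuallyEq ?_ heq
    have hpp := mem_chart_source E p
    have hψ := contDiffAt_localMap φ.contMDiff (p := p) hpp (mem_chart_source E (φ p))
    have hDψ : ContDiffAt ℝ ∞ (fun x => fderiv ℝ (localMap φ p) x e) (extChartAt 𝓘(ℝ, E) p p) :=
      (hψ.fderiv_right (m := ∞) le_rfl).clm_apply contDiffAt_const
    have hG' : ContDiffAt ℝ ∞ (fun x => localMetric g' (φ p) (localMap φ p x))
        (extChartAt 𝓘(ℝ, E) p p) := by
      refine ContDiffAt.comp (g := localMetric g' (φ p)) _ ?_ hψ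
      rw [localMap_base]
      exact contDiffAt_localMetric g' (φ p) (base_mem_target _)
    have hG := contDiffAt_localMetric g p (base_mem_target p)
    have hval : localMetric g' (φ p) (localMap φ p (extChartAt 𝓘(ℝ, E) p p))
        (fderiv ℝ (localMap φ p) (extChartAt 𝓘(ℝ, E) p p) e)
        (fderiv ℝ (localMap φ p) (extChartAt 𝓘(ℝ, E) p p) e) /
          localMetric g p (extChartAt 𝓘(ℝ, E) p p) e e ≠ 0 := by
      rw [fderiv_localMap_base φ.contMDiff, localMap_base, localMetric_base, localMetric_base]
      exact (hpos p he).ne'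
    have hF : ContDiffAt ℝ ∞ F (extChartAt 𝓘(ℝ, E) p p) := by
      refine contDiffAt_const.mul (ContDiffAt.log (ContDiffAt.div
        ((hG'.clm_apply hDψ).clm_apply hDψ)
        ((hG.clm_apply contDiffAt_const).clm_apply contDiffAt_const) ?_) hval)
      rw [localMetric_base]
      exact (form_pos g p he).ne'
    exact ContMDiffAt.comp (I' := 𝓘(ℝ, E)) p hF.contMDiffAt contMDiffAt_extChartAt
  · have h1 := pullback_proportional hZ hZ' hconj q e u v
    rw [← mul_assoc, mul_one_div_cancel two_ne_zero, one_mul, Real.exp_log (hpos q he),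
      div_mul_eq_mul_div, eq_div_iff (form_pos g q he).ne', h1]

theorem exists_orthonormal_pair (hE : 2 ≤ Module.finrank ℝ E) {B : E →L[ℝ] E →L[ℝ] ℝ}
    (hp : ∀ u, u ≠ 0 → 0 < B u u) : ∃ u v, B u u = 1 ∧ B v v = 1 ∧ B u v = 0 := by
  have hnorm : ∀ w, w ≠ 0 → ∃ r : ℝ, r * r * B w w = 1 := by
    intro w hw
    refine ⟨(√(B w w))⁻¹, ?_⟩
    rw [← mul_inv, Real.mul_self_sqrt (hp w hw).le, inv_mul_cancel₀ (hp w hw).ne']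
  have : Nontrivial E := Module.nontrivial_of_finrank_pos (R := ℝ) (by omega)
  obtain ⟨u, hu⟩ := exists_ne (0 : E)
  have hk : LinearMap.ker (B u).toLinearMap ≠ ⊥ :=
    LinearMap.ker_ne_bot_of_finrank_lt (by simp; omega)
  obtain ⟨v, hv, hv0⟩ := Submodule.exists_mem_ne_zero_of_ne_bot hk
  have hv' : B u v = 0 := hv
  obtain ⟨r, hr⟩ := hnorm u hu
  obtain ⟨s, hs⟩ := hnorm v hv0
  exact ⟨r • u, s • v, by simpa [mul_assoc] using hr, by simpa [mul_assoc] using hs, by simp [hv']⟩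

theorem mfderiv_eq_fderiv_chart {h : M → ℝ} (hh : ContMDiff 𝓘(ℝ, E) 𝓘(ℝ, ℝ) ∞ h) (p : M) :
    (mfderiv 𝓘(ℝ, E) 𝓘(ℝ, ℝ) h p : E →L[ℝ] ℝ) =
      fderiv ℝ (h ∘ (extChartAt 𝓘(ℝ, E) p).symm) (extChartAt 𝓘(ℝ, E) p p) := by
  rw [(hh.mdifferentiableAt (by simp)).mfderiv]
  simp only [ModelWithCorners.range_eq_univ, fderivWithin_univ]
  rfl

theorem eq_of_fderiv_eq_zero [ConnectedSpace M] {h : M → ℝ}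
    (hh : ContMDiff 𝓘(ℝ, E) 𝓘(ℝ, ℝ) ∞ h)
    (h0 : ∀ p, fderiv ℝ (h ∘ (extChartAt 𝓘(ℝ, E) p).symm) (extChartAt 𝓘(ℝ, E) p p) = 0)
    (p q : M) : h p = h q := by
  have hlc : IsLocallyConstant h := by
    rw [IsLocallyConstant.iff_eventually_eq]
    intro p
    obtain ⟨δ, hδ, hball⟩ := Metric.isOpen_iff.1 (isOpen_extChartAt_target (I := 𝓘(ℝ, E)) p)
      (extChartAt 𝓘(ℝ, E) p p) (base_mem_target p)
    -- `h0` concerns each point in its own chart; the chain rule through `mfderiv` moves the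
    -- vanishing to the single chart at `p`.
    have hd : ∀ x ∈ Metric.ball (extChartAt 𝓘(ℝ, E) p p) δ,
        HasFDerivAt (h ∘ (extChartAt 𝓘(ℝ, E) p).symm) (0 : E →L[ℝ] ℝ) x := by
      intro x hx
      have h1 : MDifferentiableAt 𝓘(ℝ, E) 𝓘(ℝ, E) (extChartAt 𝓘(ℝ, E) p).symm x :=
        ((contMDiffOn_extChartAt_symm (n := ∞) p).contMDiffAt
          (target_mem_nhds p (hball hx))).mdifferentiableAt (by simp)
      have h2 : HasMFDerivAt 𝓘(ℝ, E) 𝓘(ℝ, ℝ) h ((extChartAt 𝓘(ℝ, E) p).symm x)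
          (0 : E →L[ℝ] ℝ) := by
        rw [← h0 ((extChartAt 𝓘(ℝ, E) p).symm x), ← mfderiv_eq_fderiv_chart hh]
        exact (hh.mdifferentiableAt (by simp)).hasMFDerivAt
      have h3 := h2.comp x h1.hasMFDerivAt
      exact h3.hasFDerivAt.congr_fderiv (ContinuousLinearMap.zero_comp _)
    filter_upwards [(continuousAt_extChartAt (I := 𝓘(ℝ, E)) p).eventually_mem
      (Metric.ball_mem_nhds _ hδ), (chartAt E p).open_source.eventually_mem (mem_chart_source E p)]
      with q hq hqs
    have h5 := (convex_ball (extChartAt 𝓘(ℝ, E) p p) δ).is_const_of_fderivWithin_eq_zero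
      (𝕜 := ℝ) (f := h ∘ (extChartAt 𝓘(ℝ, E) p).symm)
      (fun x hx => (hd x hx).differentiableAt.differentiableWithinAt)
      (fun x hx => (hd x hx).hasFDerivWithinAt.fderivWithin
        (Metric.isOpen_ball.uniqueDiffWithinAt hx)) hq (Metric.mem_ball_self hδ)
    simpa only [Function.comp_apply, symm_extChartAt hqs, extChartAt_to_inv] using h5
  exact hlc.apply_eq_of_preconnectedSpace p q

theorem isHolomorphic_J₁_iff (hZ : IsTwistorFamily g Z) (hZ' : Z' ⊆ twistorSpace g')
    (hbase : ∀ z : Z, (f z).1.1 = φ z.1.1) (hsm : IsSmooth f) :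
    IsHolomorphic f (J₁ g) (J₁ g') ↔ ∀ z : Z, (f z).1 = conjugate φ z.1 := by
  refine ⟨fun hf => eq_conjugate_of_isHolomorphic hZ hbase hf, fun hconj => ?_⟩
  obtain ⟨h, hh, hconf⟩ := exists_conformal_factor hZ hZ' hconj
  refine (isHolomorphic_iff_conformalTerm hZ hconj hsm hh hconf 1).2 fun z X Y => ?_
  rw [one_smul]
  exact conformalTerm_holomorphic (endo_comp_of_mem (hZ.subset z.2))
    (form_endo_of_mem (hZ.subset z.2)) _ _ _

theorem isHolomorphic_J₂_iff [ConnectedSpace M] (hE : 4 ≤ Module.finrank ℝ E)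
    (hZ : IsTwistorFamily g Z) (hZ' : Z' ⊆ twistorSpace g')
    (hbase : ∀ z : Z, (f z).1.1 = φ z.1.1) (hsm : IsSmooth f) :
    IsHolomorphic f (J₂ g) (J₂ g') ↔
      (∀ z : Z, (f z).1 = conjugate φ z.1) ∧ IsHomothety g g' φ := by
  constructor
  · intro hf
    have hconj := eq_conjugate_of_isHolomorphic hZ hbase hf
    refine ⟨hconj, ?_⟩
    obtain ⟨h, hh, hconf⟩ := exists_conformal_factor hZ hZ' hconj
    have h1 := (isHolomorphic_iff_conformalTerm hZ hconj hsm hh hconf (-1)).1 hf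
    have h2 : ∀ p, gradient g h p = 0 := by
      intro p
      -- The pair only serves to produce a point of `Z` over `p`: one complex structure there
      -- already forces the gradient to vanish.
      obtain ⟨u, v, hu, hv, huv⟩ := exists_orthonormal_pair (by omega) fun u => form_pos g p (u := u)
      obtain ⟨z, hz, rfl, -⟩ := hZ.rich p u v hu hv huv
      refine eq_zero_of_conformalTerm_antiholomorphic (by omega) (form_symm g _)
        (fun _ => form_pos g _) (endo_comp_of_mem (hZ.subset hz))
        (form_endo_of_mem (hZ.subset hz)) _ fun X Y => ?_
      rw [h1 ⟨z, hz⟩ X Y, neg_one_smul]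
    have h3 := eq_of_fderiv_eq_zero hh fun p => by rw [← form_gradient, h2, map_zero]
    obtain ⟨p₀⟩ : Nonempty M := inferInstance
    exact ⟨h p₀, fun p u v => by rw [h3 p₀ p]; exact hconf p u v⟩
  · rintro ⟨hconj, c, hc⟩
    have hg : ∀ p, gradient g (fun _ => c) p = 0 := fun p => by
      have h0 : (fun _ : M => c) ∘ (extChartAt 𝓘(ℝ, E) p).symm = fun _ => c := rfl
      rw [gradient, h0, fderiv_const_apply, map_zero]
    -- With a constant factor `a = 0`, and both sides of the criterion vanish.
    refine (isHolomorphic_iff_conformalTerm hZ hconj hsm (h := fun _ => c) contMDiff_const hc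
      (-1)).2 fun z X Y => ?_
    simp [conformalTerm, hg]

end Conformal

end Twistor

end

theorem mainTheorem3 (m : ℕ)
    {E : Type*} [NormedAddCommGroup E] [NormedSpace ℝ E] [FiniteDimensional ℝ E]
    (hE : Module.finrank ℝ E = 2 * m)
    {M : Type*} [TopologicalSpace M] [ChartedSpace E M] [IsManifold 𝓘(ℝ, E) ∞ M]
    [T2Space M] [SecondCountableTopology M] [ConnectedSpace M]
    {M' : Type*} [TopologicalSpace M'] [ChartedSpace E M'] [IsManifold 𝓘(ℝ, E) ∞ M']
    [T2Space M'] [SecondCountableTopology M'] [ConnectedSpace M']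
    (g : Twistor.Metric E M) (g' : Twistor.Metric E M')
    (Z : Set (Twistor.EndTM E M)) (Z' : Set (Twistor.EndTM E M'))
    -- either the full twistor spaces, or the positive ones for some choice of orientations
    (hZ : (Z = Twistor.twistorSpace g ∧ Z' = Twistor.twistorSpace g') ∨
      ∃ (o : Twistor.ManifoldOrientation E M m) (o' : Twistor.ManifoldOrientation E M' m),
        Z = Twistor.positiveTwistorSpace g o ∧ Z' = Twistor.positiveTwistorSpace g' o')
    (Φ : Twistor.BundleIso Z Z') :
    (Twistor.IsHolomorphic Φ.toEquiv (Twistor.J₁ g) (Twistor.J₁ g') ↔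
      ∀ z : Z, (Φ.toEquiv z : Twistor.EndTM E M') = Twistor.conjugate Φ.base z) ∧
    ((∀ z : Z, (Φ.toEquiv z : Twistor.EndTM E M') = Twistor.conjugate Φ.base z) →
      Twistor.IsConformal g g' Φ.base) ∧
    (2 ≤ m →
      (Twistor.IsHolomorphic Φ.toEquiv (Twistor.J₂ g) (Twistor.J₂ g') ↔
        (∀ z : Z, (Φ.toEquiv z : Twistor.EndTM E M') = Twistor.conjugate Φ.base z) ∧
          Twistor.IsHomothety g g' Φ.base)) := by
  have hfam : Twistor.IsTwistorFamily g Z ∧ Z' ⊆ Twistor.twistorSpace g' := by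
    rcases hZ with ⟨rfl, rfl⟩ | ⟨o, o', rfl, rfl⟩
    · exact ⟨Twistor.isTwistorFamily_twistorSpace hE g, subset_rfl⟩
    · exact ⟨Twistor.isTwistorFamily_positiveTwistorSpace hE g o, fun _ hz => hz.1⟩
  exact ⟨Twistor.isHolomorphic_J₁_iff hfam.1 hfam.2 Φ.proj_toEquiv Φ.smooth_toFun,
    fun hconj => Twistor.exists_conformal_factor hfam.1 hfam.2 hconj,
    fun hm => Twistor.isHolomorphic_J₂_iff (by omega) hfam.1 hfam.2 Φ.proj_toEquiv
      Φ.smooth_toFun⟩
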